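/- Let $K$ be a field, $m \ge 2$ an integer and $q \in K$ a primitive $m$-th root of unity. Let $T = T_{m^2}(q)$ be the Taft Hopf algebra: the $K$-algebra generated by $h, x$ subject to $h^m = 1$, $x^m = 0$, $xh = qhx$, with $\Delta(h) = h \otimes h$, $\Delta(x) = x \otimes h + 1 \otimes x$, $\varepsilon(h) = 1$, $\varepsilon(x) = 0$. Let $G$ be a group generated by a set of elements of finite order, and let $K[G]$ be its group Hopf algebra. By a smash product $T \# K[G]$ we mean the Hopf algebra given by a left action $\triangleright : K[G] \otimes T \to T$ that makes $T$ a left $K[G]$-module algebra and a left $K[G]$-module coalgebra and satisfies $t_{(1)} \otimes (t_{(2)} \triangleright a) = t_{(2)} \otimes (t_{(1)} \triangleright a)$ for all $t \in K[G]$, $a \in T$. As a coalgebra it is the tensor product coalgebra $T \otimes K[G]$ (with $a \# t := a \otimes t$), and its multiplication is $(a \# t)(b \# w) = a\,(t_{(1)} \triangleright b) \# t_{(2)} w$. Let $T \# K[G]$ and $T \#' K[G]$ be two smash products, for actions $\triangleright$ and $\triangleright'$, and let $\varphi : T \# K[G] \to T \#' K[G]$ be an isomorphism of Hopf algebras. Then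 there exist coalgebra maps $u : T \to T$ and $r : K[G] \to T$ with $u(1) = 1$ and $r(1) = 1$, and a Hopf algebra automorphism $v : K[G] \to K[G]$, which is the linear extension of a group automorphism of $G$, such that for all $a \in T$ and $t \in K[G]$ $$\varphi(a \# t) = u(a)\, r(t_{(1)}) \;\#'\; v(t_{(2)}).$$ Moreover the component $p : T \to K[G]$, $p(a) = (\varepsilon \otimes \mathrm{id})\bigl(\varphi(a \# 1)\bigr)$, of $\varphi$ is trivial: $p(a) = \varepsilon(a)\,1$ for all $a \in T$. -/

import Mathlib

open scoped TensorProduct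

/-- The two generators of the Taft algebra. -/
inductive TaftGenerator where
  | h : TaftGenerator
  | x : TaftGenerator

/-- The defining relations `h ^ m = 1`, `x ^ m = 0`, `x h = q h x` of the Taft algebra. -/
inductive TaftRel (K : Type*) [Field K] (m : ℕ) (q : K) :
    FreeAlgebra K TaftGenerator → FreeAlgebra K TaftGenerator → Prop
  | h_pow : TaftRel K m q (FreeAlgebra.ι K TaftGenerator.h ^ m) 1
  | x_pow : TaftRel K m q (FreeAlgebra.ι K TaftGenerator.x ^ m) 0
  | x_mul_h : TaftRel K m q
      (FreeAlgebra.ι K TaftGenerator.x * FreeAlgebra.ι K TaftGenerator.h)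
      (q • (FreeAlgebra.ι K TaftGenerator.h * FreeAlgebra.ι K TaftGenerator.x))

/-- The Taft algebra of order `m` over `K`, for a primitive `m`-th root of unity `q`: the `K`-algebra
generated by `h` and `x` subject to `h ^ m = 1`, `x ^ m = 0`, `x h = q h x`. -/
def TaftAlgebra {K : Type*} [Field K] {m : ℕ} {q : K} (_hm : 2 ≤ m)
    (_hq : IsPrimitiveRoot q m) : Type _ :=
  RingQuot (TaftRel K m q)

namespace TaftAlgebra

section QBinomial
variable {K : Type*} [Field K]

/-- Gaussian binomial coefficients, used to check that the comultiplication below respects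
`x ^ m = 0`. -/
def qBinom (q : K) : ℕ → ℕ → K
  | _, 0 => 1
  | 0, _ + 1 => 0
  | n + 1, k + 1 => qBinom q n k + q ^ (k + 1) * qBinom q n (k + 1)

theorem qBinom_eq_zero_of_lt (q : K) : ∀ n k : ℕ, n < k → qBinom q n k = 0
  | 0, 0, h => absurd h (lt_irrefl _)
  | 0, k + 1, _ => by simp [qBinom]
  | n + 1, 0, h => absurd h (by omega)
  | n + 1, k + 1, h => by
    rw [qBinom, qBinom_eq_zero_of_lt q n k (by omega),
      qBinom_eq_zero_of_lt q n (k + 1) (by omega)]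
    simp

theorem qBinom_self (q : K) : ∀ n : ℕ, qBinom q n n = 1
  | 0 => by simp [qBinom]
  | n + 1 => by
    rw [qBinom, qBinom_self q n, qBinom_eq_zero_of_lt q n (n + 1) (by omega)]
    simp

theorem qBinom_mul (q : K) (n : ℕ) : ∀ k : ℕ,
    q ^ k * (q ^ (k + 1) - 1) * qBinom q n (k + 1) = (q ^ n - q ^ k) * qBinom q n k := by
  induction n with
  | zero =>
    intro k
    cases k <;> simp [qBinom]
  | succ n ih =>
    intro k
    cases k with
    | zero =>
      have := ih 0
      simp only [qBinom] at this ⊢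
      linear_combination q * this
    | succ k =>
      have h1 := ih k
      have h2 := ih (k + 1)
      simp only [qBinom] at h1 h2 ⊢
      linear_combination q ^ (k + 2) * h2 + q * h1

theorem qBinom_primitive {q : K} {m : ℕ} (hm : 2 ≤ m) (hq : IsPrimitiveRoot q m) :
    ∀ k : ℕ, k + 1 < m → qBinom q m (k + 1) = 0 := by
  have hq0 : q ≠ 0 := hq.ne_zero (by omega)
  intro k
  induction k with
  | zero =>
    intro h
    have h1 := qBinom_mul q m 0
    have h2 : q ^ (0 + 1) - 1 ≠ 0 := sub_ne_zero.2 (hq.pow_ne_one_of_pos_of_lt (by omega) h)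
    rw [hq.pow_eq_one, pow_zero, sub_self, zero_mul, one_mul] at h1
    exact (mul_eq_zero.1 h1).resolve_left h2
  | succ k ih =>
    intro h
    have h1 := qBinom_mul q m (k + 1)
    have h2 : q ^ (k + 1 + 1) - 1 ≠ 0 := sub_ne_zero.2 (hq.pow_ne_one_of_pos_of_lt (by omega) h)
    rw [ih (by omega), mul_zero] at h1
    exact (mul_eq_zero.1 h1).resolve_left (mul_ne_zero (pow_ne_zero _ hq0) h2)

theorem mul_pow_of_skew {B : Type*} [Ring B] [Algebra K B] {q : K} {X Y : B}
    (h : Y * X = q • (X * Y)) (k : ℕ) : Y * X ^ k = q ^ k • (X ^ k * Y) := by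
  induction k with
  | zero => simp
  | succ k ih =>
    rw [pow_succ, ← mul_assoc, ih, smul_mul_assoc, mul_assoc, h, mul_smul_comm, smul_smul,
      ← pow_succ, mul_assoc]

theorem add_pow_of_skew {B : Type*} [Ring B] [Algebra K B] {q : K} {X Y : B}
    (h : Y * X = q • (X * Y)) (n : ℕ) :
    (X + Y) ^ n = ∑ k ∈ Finset.range (n + 1), qBinom q n k • (X ^ k * Y ^ (n - k)) := by
  induction n with
  | zero => simp [qBinom]
  | succ n ih =>
    rw [pow_succ', ih, add_mul, Finset.mul_sum, Finset.mul_sum, Finset.sum_range_succ' _ (n + 1)]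
    have e1 : ∀ k ∈ Finset.range (n + 1), X * qBinom q n k • (X ^ k * Y ^ (n - k)) =
        qBinom q n k • (X ^ (k + 1) * Y ^ (n - k)) := by
      intro k _
      rw [mul_smul_comm, ← mul_assoc, ← pow_succ']
    have e2 : ∀ k ∈ Finset.range (n + 1), Y * qBinom q n k • (X ^ k * Y ^ (n - k)) =
        (q ^ k * qBinom q n k) • (X ^ k * Y ^ (n + 1 - k)) := by
      intro k hk
      have : n + 1 - k = n - k + 1 := by
        have := Finset.mem_range.1 hk
        omega
      rw [mul_smul_comm, ← mul_assoc, mul_pow_of_skew h, smul_mul_assoc, smul_smul, mul_assoc,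
        ← pow_succ', this, mul_comm]
    rw [Finset.sum_congr rfl e1, Finset.sum_congr rfl e2]
    have e3 : ∑ k ∈ Finset.range (n + 1), (q ^ k * qBinom q n k) • (X ^ k * Y ^ (n + 1 - k)) =
        ∑ k ∈ Finset.range (n + 1),
          (q ^ (k + 1) * qBinom q n (k + 1)) • (X ^ (k + 1) * Y ^ (n - k)) + Y ^ (n + 1) := by
      have := Finset.sum_range_succ
        (fun k => (q ^ k * qBinom q n k) • (X ^ k * Y ^ (n + 1 - k))) (n + 1)
      rw [qBinom_eq_zero_of_lt q n (n + 1) (by omega), mul_zero, zero_smul, add_zero] at this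
      rw [← this, Finset.sum_range_succ']
      simp [qBinom]
    rw [e3, ← add_assoc, ← Finset.sum_add_distrib]
    congr 1
    · refine Finset.sum_congr rfl fun k _ => ?_
      rw [qBinom, add_smul, Nat.add_sub_add_right]
    · simp [qBinom]

theorem add_pow_eq_zero_of_skew {B : Type*} [Ring B] [Algebra K B] {q : K} {m : ℕ} (hm : 2 ≤ m)
    (hq : IsPrimitiveRoot q m) {X Y : B} (h : Y * X = q • (X * Y)) (hX : X ^ m = 0)
    (hY : Y ^ m = 0) : (X + Y) ^ m = 0 := by
  rw [add_pow_of_skew h]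
  refine Finset.sum_eq_zero fun k hk => ?_
  have hk' := Finset.mem_range.1 hk
  rcases k with _ | k
  · simp [hY]
  · rcases Nat.lt_or_ge (k + 1) m with h1 | h1
    · rw [qBinom_primitive hm hq k h1, zero_smul]
    · obtain rfl : k + 1 = m := by omega
      simp [hX]

theorem mul_pow_eq_zero_of_skew {B : Type*} [Ring B] [Algebra K B] {c : K} {X Y : B} {m : ℕ}
    (h : X * Y = c • (Y * X)) (hX : X ^ m = 0) : (X * Y) ^ m = 0 := by
  have key : ∀ n : ℕ, ∃ t : K, (X * Y) ^ n = t • (Y ^ n * X ^ n) := by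
    intro n
    induction n with
    | zero => exact ⟨1, by simp⟩
    | succ n ih =>
      obtain ⟨t, ht⟩ := ih
      refine ⟨t * c ^ (n + 1), ?_⟩
      have h2 : X ^ (n + 1) * Y = c ^ (n + 1) • (Y * X ^ (n + 1)) := by
        generalize n + 1 = j
        induction j with
        | zero => simp
        | succ j ih =>
          rw [pow_succ', mul_assoc, ih, mul_smul_comm, ← mul_assoc, h, smul_mul_assoc, smul_smul,
            mul_assoc, pow_succ c]
      rw [pow_succ (X * Y), ht, smul_mul_assoc, mul_assoc, ← mul_assoc (X ^ n), ← pow_succ, h2,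
        mul_smul_comm, smul_smul, ← mul_assoc, ← pow_succ]
  obtain ⟨t, ht⟩ := key m
  rw [ht, hX, mul_zero, smul_zero]

end QBinomial
end TaftAlgebra

namespace TaftAlgebra
variable {K : Type*} [Field K] {m : ℕ} {q : K} (hm : 2 ≤ m) (hq : IsPrimitiveRoot q m)

noncomputable instance : Ring (TaftAlgebra hm hq) := inferInstanceAs (Ring (RingQuot (TaftRel K m q)))
noncomputable instance : Algebra K (TaftAlgebra hm hq) :=
  inferInstanceAs (Algebra K (RingQuot (TaftRel K m q)))

/-- The quotient map from the free algebra. -/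
noncomputable def proj : FreeAlgebra K TaftGenerator →ₐ[K] TaftAlgebra hm hq :=
  RingQuot.mkAlgHom K (TaftRel K m q)

/-- The generator `h`. -/
noncomputable def h : TaftAlgebra hm hq := proj hm hq (FreeAlgebra.ι K TaftGenerator.h)

/-- The generator `x`. -/
noncomputable def x : TaftAlgebra hm hq := proj hm hq (FreeAlgebra.ι K TaftGenerator.x)

theorem proj_surjective : Function.Surjective (proj hm hq) :=
  RingQuot.mkAlgHom_surjective K (TaftRel K m q)

theorem h_pow : h hm hq ^ m = 1 := by
  rw [h, ← map_pow, ← map_one (proj hm hq)]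
  exact RingQuot.mkAlgHom_rel K TaftRel.h_pow

theorem x_pow : x hm hq ^ m = 0 := by
  rw [x, ← map_pow, ← map_zero (proj hm hq)]
  exact RingQuot.mkAlgHom_rel K TaftRel.x_pow

theorem x_mul_h : x hm hq * h hm hq = q • (h hm hq * x hm hq) := by
  rw [x, h, ← map_mul, ← map_mul, ← map_smul]
  exact RingQuot.mkAlgHom_rel K TaftRel.x_mul_h

section lift
variable {B : Type*} [Ring B] [Algebra K B]

/-- The universal property of the presentation. -/
noncomputable def lift (bh bx : B) (h1 : bh ^ m = 1) (h2 : bx ^ m = 0)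
    (h3 : bx * bh = q • (bh * bx)) : TaftAlgebra hm hq →ₐ[K] B :=
  RingQuot.liftAlgHom K ⟨FreeAlgebra.lift K (fun i => TaftGenerator.casesOn i bh bx), by
    rintro _ _ (_ | _ | _)
    · simpa using h1
    · simpa using h2
    · simpa using h3⟩

theorem lift_h (bh bx : B) (h1 : bh ^ m = 1) (h2 : bx ^ m = 0)
    (h3 : bx * bh = q • (bh * bx)) : lift hm hq bh bx h1 h2 h3 (h hm hq) = bh := by
  simp only [lift, h, proj]
  erw [RingQuot.liftAlgHom_mkAlgHom_apply]
  simp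

theorem lift_x (bh bx : B) (h1 : bh ^ m = 1) (h2 : bx ^ m = 0)
    (h3 : bx * bh = q • (bh * bx)) : lift hm hq bh bx h1 h2 h3 (x hm hq) = bx := by
  simp only [lift, x, proj]
  erw [RingQuot.liftAlgHom_mkAlgHom_apply]
  simp

theorem algHom_ext {B : Type*} [Semiring B] [Algebra K B] {f g : TaftAlgebra hm hq →ₐ[K] B}
    (h1 : f (h hm hq) = g (h hm hq)) (h2 : f (x hm hq) = g (x hm hq)) : f = g := by
  have : f.comp (proj hm hq) = g.comp (proj hm hq) := by
    apply FreeAlgebra.hom_ext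
    funext i
    cases i
    · exact h1
    · exact h2
  apply AlgHom.ext
  intro a
  obtain ⟨b, rfl⟩ := proj_surjective hm hq a
  exact DFunLike.congr_fun this b

theorem induction {P : TaftAlgebra hm hq → Prop} (hc : ∀ c : K, P (algebraMap K _ c))
    (hh : P (h hm hq)) (hx : P (x hm hq)) (hadd : ∀ a b, P a → P b → P (a + b))
    (hmul : ∀ a b, P a → P b → P (a * b)) (a : TaftAlgebra hm hq) : P a := by
  obtain ⟨b, rfl⟩ := proj_surjective hm hq a
  induction b using FreeAlgebra.induction with
  | grade0 c => rw [AlgHom.commutes]; exact hc c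
  | grade1 i => cases i <;> assumption
  | mul a b ha hb => rw [map_mul]; exact hmul _ _ ha hb
  | add a b ha hb => rw [map_add]; exact hadd _ _ ha hb

end lift

/-- The comultiplication: `h` is mapped to `h ⊗ h` and `x` to `x ⊗ h + 1 ⊗ x`. -/
noncomputable def comulHom : TaftAlgebra hm hq →ₐ[K] TaftAlgebra hm hq ⊗[K] TaftAlgebra hm hq :=
  lift hm hq (h hm hq ⊗ₜ h hm hq) (x hm hq ⊗ₜ h hm hq + 1 ⊗ₜ x hm hq)
    (by rw [Algebra.TensorProduct.tmul_pow, h_pow, Algebra.TensorProduct.one_def])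
    (add_pow_eq_zero_of_skew hm hq
      (by simp [x_mul_h])
      (by rw [Algebra.TensorProduct.tmul_pow, x_pow, TensorProduct.zero_tmul])
      (by rw [Algebra.TensorProduct.tmul_pow, x_pow, TensorProduct.tmul_zero]))
    (by simp [add_mul, mul_add, x_mul_h, TensorProduct.smul_tmul'])

/-- The counit: `h` is mapped to `1` and `x` to `0`. -/
noncomputable def counitHom : TaftAlgebra hm hq →ₐ[K] K :=
  lift hm hq 1 0 (one_pow m) (zero_pow (by omega)) (by simp)

noncomputable instance : Bialgebra K (TaftAlgebra hm hq) :=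
  Bialgebra.ofAlgHom (comulHom hm hq) (counitHom hm hq)
    (by
      apply algHom_ext
      · simp [comulHom, lift_h]
      · simp [comulHom, lift_x, lift_h, TensorProduct.add_tmul, TensorProduct.tmul_add,
          Algebra.TensorProduct.one_def, add_assoc])
    (by
      apply algHom_ext
      · simp [comulHom, counitHom, lift_h]
      · simp [comulHom, counitHom, lift_x])
    (by
      apply algHom_ext
      · simp [comulHom, counitHom, lift_h]
      · simp [comulHom, counitHom, lift_x, lift_h])

theorem comul_h : Coalgebra.comul (R := K) (h hm hq) = h hm hq ⊗ₜ h hm hq := lift_h ..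

theorem comul_x : Coalgebra.comul (R := K) (x hm hq) = x hm hq ⊗ₜ h hm hq + 1 ⊗ₜ x hm hq :=
  lift_x ..

theorem counit_h : Coalgebra.counit (R := K) (h hm hq) = 1 := lift_h ..

theorem counit_x : Coalgebra.counit (R := K) (x hm hq) = 0 := lift_x ..

theorem h_mul_h_pow : h hm hq * h hm hq ^ (m - 1) = 1 := by
  rw [← pow_succ', Nat.sub_add_cancel (by omega), h_pow]

theorem h_pow_mul_h : h hm hq ^ (m - 1) * h hm hq = 1 := by
  rw [← pow_succ, Nat.sub_add_cancel (by omega), h_pow]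

theorem h_pow_mul_x : h hm hq ^ (m - 1) * x hm hq = q • (x hm hq * h hm hq ^ (m - 1)) := by
  calc h hm hq ^ (m - 1) * x hm hq
      = h hm hq ^ (m - 1) * (x hm hq * h hm hq) * h hm hq ^ (m - 1) := by
        rw [mul_assoc, mul_assoc, h_mul_h_pow, mul_one]
    _ = q • (h hm hq ^ (m - 1) * h hm hq * x hm hq * h hm hq ^ (m - 1)) := by
        rw [x_mul_h, mul_smul_comm, smul_mul_assoc, ← mul_assoc]
    _ = _ := by rw [h_pow_mul_h, one_mul]

theorem x_mul_h_pow_pow : (x hm hq * h hm hq ^ (m - 1)) ^ m = 0 := by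
  refine mul_pow_eq_zero_of_skew (c := q⁻¹) ?_ (x_pow hm hq)
  rw [h_pow_mul_x, smul_smul, inv_mul_cancel₀ (hq.ne_zero (by omega)), one_smul]

/-- The antipode, as an anti-homomorphism of algebras: `S h = h ^ (m - 1)` and
`S x = - x h ^ (m - 1)`. -/
noncomputable def antipodeHom : TaftAlgebra hm hq →ₐ[K] (TaftAlgebra hm hq)ᵐᵒᵖ :=
  lift hm hq (MulOpposite.op (h hm hq ^ (m - 1)))
    (MulOpposite.op (-(x hm hq * h hm hq ^ (m - 1))))
    (by rw [← MulOpposite.op_pow, ← pow_mul, mul_comm, pow_mul, h_pow, one_pow, MulOpposite.op_one])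
    (by rw [← MulOpposite.op_pow, neg_pow, x_mul_h_pow_pow, mul_zero, MulOpposite.op_zero])
    (by
      rw [← MulOpposite.op_mul, ← MulOpposite.op_mul, ← MulOpposite.op_smul, mul_neg, ← mul_assoc, h_pow_mul_x, smul_mul_assoc,
        neg_mul, smul_neg])

/-- The antipode of the Taft algebra as a linear map. -/
noncomputable def antipodeMap : TaftAlgebra hm hq →ₗ[K] TaftAlgebra hm hq :=
  (MulOpposite.opLinearEquiv K).symm.toLinearMap ∘ₗ (antipodeHom hm hq).toLinearMap

theorem antipodeMap_h : antipodeMap hm hq (h hm hq) = h hm hq ^ (m - 1) := by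
  simp [antipodeMap, antipodeHom, lift_h]

theorem antipodeMap_x : antipodeMap hm hq (x hm hq) = -(x hm hq * h hm hq ^ (m - 1)) := by
  simp [antipodeMap, antipodeHom, lift_x]

theorem antipodeMap_one : antipodeMap hm hq 1 = 1 := by
  simp [antipodeMap]

theorem antipodeMap_mul (a b : TaftAlgebra hm hq) :
    antipodeMap hm hq (a * b) = antipodeMap hm hq b * antipodeMap hm hq a := by
  simp [antipodeMap]

theorem antipodeMap_left (a : TaftAlgebra hm hq) :
    LinearMap.mul' K _ ((antipodeMap hm hq).rTensor _ (Coalgebra.comul (R := K) a)) =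
      Coalgebra.counit (R := K) a • 1 := by
  induction a using TaftAlgebra.induction with
  | hc c => simp [Algebra.algebraMap_eq_smul_one, Algebra.TensorProduct.one_def,
      antipodeMap_one]
  | hh => simp [comul_h, counit_h, antipodeMap_h, h_pow_mul_h]
  | hx => simp [comul_x, counit_x, antipodeMap_x, antipodeMap_one, mul_assoc, h_pow_mul_h]
  | hadd a b ha hb => simp only [map_add, ha, hb, add_smul]
  | hmul a b ha hb =>
    have key1 : ∀ (v : TaftAlgebra hm hq ⊗[K] TaftAlgebra hm hq) (p r : TaftAlgebra hm hq),
        LinearMap.mul' K _ ((antipodeMap hm hq).rTensor _ (v * (p ⊗ₜ r))) =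
        antipodeMap hm hq p * LinearMap.mul' K _ ((antipodeMap hm hq).rTensor _ v) * r := by
      intro v p r
      induction v with
      | zero => simp
      | add s t hs ht => simp only [map_add, add_mul, mul_add, hs, ht]
      | tmul c d => simp [antipodeMap_mul, mul_assoc]
    have key2 : ∀ w : TaftAlgebra hm hq ⊗[K] TaftAlgebra hm hq,
        LinearMap.mul' K _ ((antipodeMap hm hq).rTensor _ (Coalgebra.comul (R := K) a * w)) =
        Coalgebra.counit (R := K) a • LinearMap.mul' K _ ((antipodeMap hm hq).rTensor _ w) := by
      intro w
      induction w with
      | zero => simp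
      | add s t hs ht => simp only [map_add, mul_add, smul_add, hs, ht]
      | tmul c d => rw [key1, ha]; simp
    rw [Bialgebra.comul_mul, key2, hb, Bialgebra.counit_mul, smul_smul]

theorem antipodeMap_right (a : TaftAlgebra hm hq) :
    LinearMap.mul' K _ ((antipodeMap hm hq).lTensor _ (Coalgebra.comul (R := K) a)) =
      Coalgebra.counit (R := K) a • 1 := by
  induction a using TaftAlgebra.induction with
  | hc c => simp [Algebra.algebraMap_eq_smul_one, Algebra.TensorProduct.one_def,
      antipodeMap_one]
  | hh => simp [comul_h, counit_h, antipodeMap_h, h_mul_h_pow]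
  | hx => simp [comul_x, counit_x, antipodeMap_x, antipodeMap_h]
  | hadd a b ha hb => simp only [map_add, ha, hb, add_smul]
  | hmul a b ha hb =>
    have key1 : ∀ (v : TaftAlgebra hm hq ⊗[K] TaftAlgebra hm hq) (p r : TaftAlgebra hm hq),
        LinearMap.mul' K _ ((antipodeMap hm hq).lTensor _ ((p ⊗ₜ r) * v)) =
        p * LinearMap.mul' K _ ((antipodeMap hm hq).lTensor _ v) * antipodeMap hm hq r := by
      intro v p r
      induction v with
      | zero => simp
      | add s t hs ht => simp only [map_add, add_mul, mul_add, hs, ht]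
      | tmul c d => simp [antipodeMap_mul, mul_assoc]
    have key2 : ∀ w : TaftAlgebra hm hq ⊗[K] TaftAlgebra hm hq,
        LinearMap.mul' K _ ((antipodeMap hm hq).lTensor _ (w * Coalgebra.comul (R := K) b)) =
        Coalgebra.counit (R := K) b • LinearMap.mul' K _ ((antipodeMap hm hq).lTensor _ w) := by
      intro w
      induction w with
      | zero => simp
      | add s t hs ht => simp only [map_add, add_mul, smul_add, hs, ht]
      | tmul c d => rw [key1, hb]; simp
    rw [Bialgebra.comul_mul, key2, ha, Bialgebra.counit_mul, smul_smul, mul_comm]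

/-- The Taft Hopf algebra. -/
noncomputable instance : HopfAlgebra K (TaftAlgebra hm hq) where
  antipode := antipodeMap hm hq
  mul_antipode_rTensor_comul := by
    apply LinearMap.ext
    intro a
    simpa [Algebra.algebraMap_eq_smul_one] using antipodeMap_left hm hq a
  mul_antipode_lTensor_comul := by
    apply LinearMap.ext
    intro a
    simpa [Algebra.algebraMap_eq_smul_one] using antipodeMap_right hm hq a

end TaftAlgebra

/-- The data that define a smash product `A # H` of Hopf algebras: a left action of `H` on `A` that
makes `A` a left `H`-module algebra and a left `H`-module coalgebra, with the compatibility
`y₁ ⊗ (y₂ ▷ a) = y₂ ⊗ (y₁ ▷ a)`. Sweedler indices are written `y₁`, `y₂`. -/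
structure SmashAction (K A H : Type*) [Field K] [Ring A] [HopfAlgebra K A]
    [Ring H] [HopfAlgebra K H] where
  /-- The action, `act y a` being `y ▷ a`. -/
  act : H →ₗ[K] A →ₗ[K] A
  one_act : ∀ a : A, act 1 a = a
  mul_act : ∀ (y z : H) (a : A), act (y * z) a = act y (act z a)
  /-- Module algebra: `y ▷ 1 = ε(y) 1`. -/
  act_one : ∀ y : H, act y 1 = Coalgebra.counit (R := K) y • (1 : A)
  /-- Module algebra: `y ▷ (a b) = (y₁ ▷ a) (y₂ ▷ b)`. -/
  act_mul : ∀ (y : H) (a b : A), act y (a * b) =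
    LinearMap.mul' K A (TensorProduct.map (act.flip a) (act.flip b) (Coalgebra.comul y))
  /-- Module coalgebra: `ε(y ▷ a) = ε(y) ε(a)`. -/
  counit_act : ∀ (y : H) (a : A), Coalgebra.counit (R := K) (act y a) =
    Coalgebra.counit (R := K) y * Coalgebra.counit (R := K) a
  /-- Module coalgebra: `Δ(y ▷ a) = (y₁ ▷ a₁) ⊗ (y₂ ▷ a₂)`. -/
  comul_act : ∀ (y : H) (a : A), Coalgebra.comul (R := K) (act y a) =
    TensorProduct.map₂ act act (Coalgebra.comul y) (Coalgebra.comul a)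
  /-- `y₁ ⊗ (y₂ ▷ a) = y₂ ⊗ (y₁ ▷ a)`. -/
  compat : ∀ (y : H) (a : A),
    TensorProduct.map LinearMap.id (act.flip a) (Coalgebra.comul y) =
    TensorProduct.map LinearMap.id (act.flip a)
      (TensorProduct.comm K H H (Coalgebra.comul y))

section
variable {K A H : Type*} [Field K] [Ring A] [HopfAlgebra K A] [Ring H] [HopfAlgebra K H]

/-- The smash product `A # H`: the tensor coalgebra `A ⊗ H`, with the multiplication
`(a # y) (b # z) = a (y₁ ▷ b) # y₂ z` given below. -/
def SmashProduct (_α : SmashAction K A H) : Type _ := A ⊗[K] H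

namespace SmashProduct
variable (α : SmashAction K A H)

noncomputable instance : AddCommGroup (SmashProduct α) :=
  inferInstanceAs (AddCommGroup (A ⊗[K] H))
noncomputable instance : Module K (SmashProduct α) := inferInstanceAs (Module K (A ⊗[K] H))
/-- The coalgebra structure is that of the tensor product coalgebra. -/
noncomputable instance : Coalgebra K (SmashProduct α) :=
  inferInstanceAs (Coalgebra K (A ⊗[K] H))

/-- The identity map `A ⊗ H → A # H`. -/
noncomputable def ofTensor : A ⊗[K] H ≃ₗ[K] SmashProduct α := LinearEquiv.refl K (A ⊗[K] H)

/-- The element `a # y`. -/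
noncomputable def mk (a : A) (y : H) : SmashProduct α := ofTensor α (a ⊗ₜ[K] y)

/-- The bilinear multiplication map of `A # H`, see `mulTensor_tmul_tmul`. -/
noncomputable def mulTensor : A ⊗[K] H →ₗ[K] A ⊗[K] H →ₗ[K] A ⊗[K] H :=
  TensorProduct.lift (LinearMap.mk₂ K
    (fun (a : A) (y : H) =>
      TensorProduct.map (LinearMap.mul K A a) LinearMap.id ∘ₗ
        TensorProduct.map₂ α.act (LinearMap.mul K H) (Coalgebra.comul y))
    (fun a a' y => by simp [TensorProduct.map_add_left, LinearMap.add_comp])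
    (fun c a y => by simp [TensorProduct.map_smul_left, LinearMap.smul_comp])
    (fun a y y' => by simp [LinearMap.comp_add])
    (fun c a y => by simp [LinearMap.comp_smul]))

/-- `(a # y) (b # z) = a (y₁ ▷ b) # y₂ z`. -/
theorem mulTensor_tmul_tmul (a b : A) (y z : H) :
    mulTensor α (a ⊗ₜ[K] y) (b ⊗ₜ[K] z) =
      TensorProduct.map (LinearMap.mul K A a ∘ₗ α.act.flip b) ((LinearMap.mul K H).flip z)
        (Coalgebra.comul y) := by
  simp only [mulTensor, TensorProduct.lift.tmul, LinearMap.mk₂_apply, LinearMap.comp_apply]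
  induction (Coalgebra.comul (R := K) y) with
  | zero => simp
  | tmul p r => simp
  | add s t hs ht => simp only [map_add, LinearMap.add_apply, hs, ht]

theorem one_mulTensor (s : A ⊗[K] H) : mulTensor α (1 ⊗ₜ 1) s = s := by
  induction s with
  | zero => simp
  | tmul b z => simp [mulTensor_tmul_tmul, Algebra.TensorProduct.one_def, α.one_act]
  | add s t hs ht => simp only [map_add, hs, ht]

theorem mulTensor_tmul_tmul_one_left (a b : A) (z : H) :
    mulTensor α (a ⊗ₜ 1) (b ⊗ₜ z) = (a * b) ⊗ₜ z := by
  simp [mulTensor_tmul_tmul, Algebra.TensorProduct.one_def, α.one_act]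

theorem mulTensor_tmul_one_tmul (a : A) (y z : H) :
    mulTensor α (a ⊗ₜ y) (1 ⊗ₜ z) = a ⊗ₜ (y * z) := by
  have key : ∀ w : H ⊗[K] H,
      TensorProduct.map (LinearMap.mul K A a ∘ₗ α.act.flip 1) ((LinearMap.mul K H).flip z) w =
      a ⊗ₜ ((TensorProduct.lid K H (Coalgebra.counit.rTensor H w)) * z) := by
    intro w
    induction w with
    | zero => simp
    | tmul p r => simp [α.act_one, TensorProduct.smul_tmul]
    | add s t hs ht => simp only [map_add, hs, ht, add_mul, TensorProduct.tmul_add]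
  rw [mulTensor_tmul_tmul, key]
  simp

theorem mulTensor_one (s : A ⊗[K] H) : mulTensor α s (1 ⊗ₜ 1) = s := by
  induction s with
  | zero => simp
  | tmul b z => simp [mulTensor_tmul_one_tmul]
  | add s t hs ht => simp only [map_add, hs, ht, LinearMap.add_apply]

theorem mulTensor_one_left_mul (y z : H) :
    mulTensor α (1 ⊗ₜ (y * z)) = mulTensor α (1 ⊗ₜ y) ∘ₗ mulTensor α (1 ⊗ₜ z) := by
  have e : ∀ y : H, mulTensor α (1 ⊗ₜ[K] y) =
      TensorProduct.map₂ α.act (LinearMap.mul K H) (Coalgebra.comul y) := by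
    intro y
    have h1 : LinearMap.mul K A 1 = LinearMap.id := by ext; simp
    simp only [mulTensor, TensorProduct.lift.tmul, LinearMap.mk₂_apply, h1, TensorProduct.map_id,
      LinearMap.id_comp]
  have key : ∀ v w : H ⊗[K] H, TensorProduct.map₂ α.act (LinearMap.mul K H) (v * w) =
      TensorProduct.map₂ α.act (LinearMap.mul K H) v ∘ₗ
        TensorProduct.map₂ α.act (LinearMap.mul K H) w := by
    intro v w
    induction v with
    | zero => simp
    | add s t hs ht => simp only [map_add, add_mul, hs, ht, LinearMap.add_comp]
    | tmul p r =>
      induction w with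
      | zero => simp
      | add s t hs ht => simp only [map_add, mul_add, hs, ht, LinearMap.comp_add]
      | tmul p' r' => ext; simp [α.mul_act, mul_assoc]
  rw [e, e, e, Bialgebra.comul_mul, key]

theorem mulTensor_tmul (a : A) (y : H) :
    mulTensor α (a ⊗ₜ y) = (LinearMap.mul K A a).rTensor H ∘ₗ mulTensor α (1 ⊗ₜ y) := by
  ext b z
  simp only [TensorProduct.AlgebraTensorModule.curry_apply, TensorProduct.curry_apply,
    LinearMap.coe_restrictScalars, LinearMap.comp_apply, mulTensor_tmul_tmul]
  induction (Coalgebra.comul (R := K) y) with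
  | zero => simp
  | tmul p r => simp
  | add s t hs ht => simp only [map_add, hs, ht]

theorem mulTensor_mul_left (a : A) (s : A ⊗[K] H) :
    mulTensor α ((LinearMap.mul K A a).rTensor H s) =
      (LinearMap.mul K A a).rTensor H ∘ₗ mulTensor α s := by
  induction s with
  | zero => simp
  | add s t hs ht => simp only [map_add, hs, ht, LinearMap.comp_add]
  | tmul b y =>
    ext c z
    simp only [LinearMap.rTensor_tmul, LinearMap.mul_apply']
    rw [mulTensor_tmul α (a * b), mulTensor_tmul α b]
    have : LinearMap.mul K A (a * b) = LinearMap.mul K A a ∘ₗ LinearMap.mul K A b := by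
      ext; simp [mul_assoc]
    rw [this, LinearMap.rTensor_comp, LinearMap.comp_assoc]

theorem mulTensor_cross (y : H) (b : A) :
    mulTensor α (mulTensor α (1 ⊗ₜ y) (b ⊗ₜ 1)) =
      mulTensor α (1 ⊗ₜ y) ∘ₗ mulTensor α (b ⊗ₜ 1) := by
  ext c z
  simp only [TensorProduct.AlgebraTensorModule.curry_apply, TensorProduct.curry_apply,
    LinearMap.coe_restrictScalars, LinearMap.comp_apply, mulTensor_tmul_tmul_one_left]
  rw [mulTensor_tmul_tmul, mulTensor_tmul_tmul]
  let G : H ⊗[K] (H ⊗[K] H) →ₗ[K] A ⊗[K] H := TensorProduct.lift (LinearMap.mk₂ K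
    (fun (p : H) (w : H ⊗[K] H) =>
      TensorProduct.map (LinearMap.mul K A (α.act p b) ∘ₗ α.act.flip c)
        ((LinearMap.mul K H).flip z) w)
    (fun p p' w => by simp [TensorProduct.map_add_left, LinearMap.add_comp])
    (fun k p w => by simp [TensorProduct.map_smul_left, LinearMap.smul_comp])
    (fun p w w' => by simp)
    (fun k p w => by simp))
  have h1 : ∀ w : H ⊗[K] H, mulTensor α
      (TensorProduct.map (LinearMap.mul K A 1 ∘ₗ α.act.flip b) ((LinearMap.mul K H).flip 1) w)
        (c ⊗ₜ z) = G (Coalgebra.comul.lTensor H w) := by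
    intro w
    induction w with
    | zero => simp
    | add s t hs ht => simp only [map_add, LinearMap.add_apply, hs, ht]
    | tmul p r => simp [G, mulTensor_tmul_tmul]
  have h2 : ∀ w : H ⊗[K] H,
      TensorProduct.map (LinearMap.mul K A 1 ∘ₗ α.act.flip (b * c)) ((LinearMap.mul K H).flip z) w
        = G (TensorProduct.assoc K H H H (Coalgebra.comul.rTensor H w)) := by
    intro w
    induction w with
    | zero => simp
    | add s t hs ht => simp only [map_add, hs, ht]
    | tmul p r =>
      simp only [TensorProduct.map_tmul, LinearMap.comp_apply, LinearMap.flip_apply, α.act_mul,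
        LinearMap.rTensor_tmul, LinearMap.mul_apply', one_mul]
      induction (Coalgebra.comul (R := K) p) with
      | zero => simp
      | add s t hs ht => simp only [map_add, TensorProduct.add_tmul, hs, ht]
      | tmul p' r' => simp [G]
  rw [h1, h2, Coalgebra.coassoc_apply]

theorem mulTensor_assoc (s t w : A ⊗[K] H) :
    mulTensor α (mulTensor α s t) w = mulTensor α s (mulTensor α t w) := by
  induction s with
  | zero => simp
  | add s t hs ht => simp only [map_add, LinearMap.add_apply, hs, ht]
  | tmul a y =>
    induction t with
    | zero => simp
    | add s t hs ht => simp only [map_add, LinearMap.add_apply, hs, ht]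
    | tmul b z =>
      have right : ∀ (x : A ⊗[K] H), mulTensor α (mulTensor α x (1 ⊗ₜ z)) =
          mulTensor α x ∘ₗ mulTensor α (1 ⊗ₜ z) := by
        intro x
        induction x with
        | zero => simp
        | add s t hs ht => simp only [map_add, LinearMap.add_apply, LinearMap.add_comp, hs, ht]
        | tmul c v =>
          rw [mulTensor_tmul_one_tmul, mulTensor_tmul, mulTensor_one_left_mul,
            mulTensor_tmul α c v, LinearMap.comp_assoc]
      have hb : b ⊗ₜ[K] z = mulTensor α (b ⊗ₜ 1) (1 ⊗ₜ z) := by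
        rw [mulTensor_tmul_one_tmul, one_mul]
      have key : mulTensor α (mulTensor α (1 ⊗ₜ y) (b ⊗ₜ z)) =
          mulTensor α (1 ⊗ₜ y) ∘ₗ mulTensor α (b ⊗ₜ z) := by
        have e : mulTensor α (1 ⊗ₜ y) (b ⊗ₜ z) =
            mulTensor α (mulTensor α (1 ⊗ₜ y) (b ⊗ₜ 1)) (1 ⊗ₜ z) := by
          rw [mulTensor_cross, LinearMap.comp_apply, ← hb]
        rw [e, right, mulTensor_cross, LinearMap.comp_assoc, hb, right]
      rw [mulTensor_tmul, LinearMap.comp_apply, mulTensor_mul_left, key]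
      rfl

noncomputable instance : One (SmashProduct α) := ⟨ofTensor α (1 ⊗ₜ[K] 1)⟩

noncomputable instance : Mul (SmashProduct α) :=
  ⟨fun s t => ofTensor α (mulTensor α ((ofTensor α).symm s) ((ofTensor α).symm t))⟩

noncomputable instance : Ring (SmashProduct α) :=
  { (inferInstance : AddCommGroup (SmashProduct α)),
    (inferInstance : One (SmashProduct α)),
    (inferInstance : Mul (SmashProduct α)) with
    left_distrib := fun a b c => map_add (mulTensor α a) b c
    right_distrib := fun a b c => LinearMap.map_add₂ (mulTensor α) a b c
    zero_mul := fun a => LinearMap.map_zero₂ (mulTensor α) a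
    mul_zero := fun a => map_zero (mulTensor α a)
    mul_assoc := fun a b c => mulTensor_assoc α a b c
    one_mul := fun a => one_mulTensor α a
    mul_one := fun a => mulTensor_one α a }

noncomputable instance : Algebra K (SmashProduct α) :=
  Algebra.ofModule (fun k s t => LinearMap.map_smul₂ (mulTensor α) k s t)
    (fun k s t => map_smul (mulTensor α s) k t)


/-- `a # y` as a bilinear map. -/
noncomputable def mkₗ : A →ₗ[K] H →ₗ[K] SmashProduct α :=
  (TensorProduct.mk K A H).compr₂ (ofTensor α).toLinearMap

theorem mkₗ_apply (a : A) (y : H) : mkₗ α a y = mk α a y := rfl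

theorem comul_mk (a : A) (y : H) : Coalgebra.comul (R := K) (mk α a y) =
    TensorProduct.map₂ (mkₗ α) (mkₗ α) (Coalgebra.comul a) (Coalgebra.comul y) := by
  have key : ∀ (v : A ⊗[K] A) (w : H ⊗[K] H),
      (TensorProduct.AlgebraTensorModule.tensorTensorTensorComm K K K K A A H H (v ⊗ₜ w) :
        (A ⊗[K] H) ⊗[K] (A ⊗[K] H)) =
      TensorProduct.map₂ (TensorProduct.mk K A H) (TensorProduct.mk K A H) v w := by
    intro v w
    induction v with
    | zero => simp
    | add s t hs ht => simp only [map_add, TensorProduct.add_tmul, LinearMap.add_apply, hs, ht]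
    | tmul p r =>
      induction w with
      | zero => simp
      | add s t hs ht => simp only [map_add, TensorProduct.tmul_add, hs, ht]
      | tmul p' r' => simp
  exact key _ _

theorem counit_mk (a : A) (y : H) : Coalgebra.counit (R := K) (mk α a y) =
    Coalgebra.counit (R := K) a * Coalgebra.counit (R := K) y := mul_comm _ _

/-- `(a # y) (b # z) = a (y₁ ▷ b) # y₂ z`. -/
theorem mk_mul_mk (a b : A) (y z : H) : mk α a y * mk α b z =
    ofTensor α (TensorProduct.map (LinearMap.mul K A a ∘ₗ α.act.flip b) ((LinearMap.mul K H).flip z)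
        (Coalgebra.comul y)) :=
  congrArg (ofTensor α) (mulTensor_tmul_tmul α a b y z)

theorem mk_one_mul_mk (a b : A) (z : H) : mk α a 1 * mk α b z = mk α (a * b) z :=
  mulTensor_tmul_tmul_one_left α a b z

theorem mk_mul_mk_one (a : A) (y z : H) : mk α a y * mk α 1 z = mk α a (y * z) :=
  mulTensor_tmul_one_tmul α a y z

theorem one_def : (1 : SmashProduct α) = mk α 1 1 := rfl

theorem mk_eq_mul (a : A) (y : H) : mk α a y = mk α a 1 * mk α 1 y := by
  rw [mk_one_mul_mk, mul_one]

theorem induction {P : SmashProduct α → Prop} (h0 : P 0) (hmk : ∀ a y, P (mk α a y))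
    (hadd : ∀ s t, P s → P t → P (s + t)) (s : SmashProduct α) : P s :=
  TensorProduct.induction_on (motive := P) s h0 hmk hadd

theorem comul_mk_one_mul (a b : A) (z : H) : Coalgebra.comul (R := K) (mk α a 1 * mk α b z) =
    Coalgebra.comul (R := K) (mk α a 1) * Coalgebra.comul (R := K) (mk α b z) := by
  rw [mk_one_mul_mk, comul_mk, comul_mk, comul_mk, Bialgebra.comul_mul, Bialgebra.comul_one]
  induction (Coalgebra.comul (R := K) a) with
  | zero => simp
  | add s t hs ht => simp only [map_add, LinearMap.add_apply, add_mul, hs, ht]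
  | tmul p r =>
    induction (Coalgebra.comul (R := K) b) with
    | zero => simp
    | add s t hs ht => simp only [map_add, LinearMap.add_apply, mul_add, hs, ht]
    | tmul p' r' =>
      induction (Coalgebra.comul (R := K) z) with
      | zero => simp
      | add s t hs ht => simp only [map_add, mul_add, hs, ht]
      | tmul p'' r'' =>
        simp [mkₗ_apply, Algebra.TensorProduct.one_def, mk_one_mul_mk]

theorem comul_mul_mk_one (a : A) (y z : H) : Coalgebra.comul (R := K) (mk α a y * mk α 1 z) =
    Coalgebra.comul (R := K) (mk α a y) * Coalgebra.comul (R := K) (mk α 1 z) := by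
  rw [mk_mul_mk_one, comul_mk, comul_mk, comul_mk, Bialgebra.comul_mul, Bialgebra.comul_one]
  induction (Coalgebra.comul (R := K) a) with
  | zero => simp
  | add s t hs ht => simp only [map_add, LinearMap.add_apply, add_mul, hs, ht]
  | tmul p r =>
    induction (Coalgebra.comul (R := K) y) with
    | zero => simp
    | add s t hs ht => simp only [map_add, add_mul, hs, ht]
    | tmul p' r' =>
      induction (Coalgebra.comul (R := K) z) with
      | zero => simp
      | add s t hs ht => simp only [map_add, mul_add, hs, ht]
      | tmul p'' r'' =>
        simp [mkₗ_apply, Algebra.TensorProduct.one_def, mk_mul_mk_one]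

/-- The reassociation `p ⊗ ((q ⊗ s) ⊗ t) ↦ (p ⊗ q) ⊗ (s ⊗ t)`. -/
noncomputable def shuffle : H ⊗[K] ((H ⊗[K] H) ⊗[K] H) →ₗ[K] (H ⊗[K] H) ⊗[K] (H ⊗[K] H) :=
  (TensorProduct.assoc K H H (H ⊗[K] H)).symm.toLinearMap ∘ₗ
    (TensorProduct.assoc K H H H).toLinearMap.lTensor H

theorem map_comul_comul (y : H) :
    TensorProduct.map Coalgebra.comul Coalgebra.comul (Coalgebra.comul (R := K) y) =
    shuffle (Coalgebra.comul.rTensor H |>.lTensor H <| Coalgebra.comul.lTensor H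
      (Coalgebra.comul (R := K) y)) := by
  have h2 : ∀ w : H ⊗[K] H, shuffle (Coalgebra.comul.rTensor H |>.lTensor H <|
      Coalgebra.comul.lTensor H w) = (TensorProduct.assoc K H H (H ⊗[K] H)).symm
        (Coalgebra.comul.lTensor H |>.lTensor H <| Coalgebra.comul.lTensor H w) := by
    intro w
    induction w with
    | zero => simp
    | add s t hs ht => simp only [map_add, hs, ht]
    | tmul p r => simp [shuffle, Coalgebra.coassoc_apply]
  have h3 : ∀ w : H ⊗[K] (H ⊗[K] H), (TensorProduct.assoc K H H (H ⊗[K] H)).symm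
        (Coalgebra.comul.lTensor H |>.lTensor H <| w) =
      Coalgebra.comul.lTensor (H ⊗[K] H) ((TensorProduct.assoc K H H H).symm w) := by
    intro w
    induction w with
    | zero => simp
    | add s t hs ht => simp only [map_add, hs, ht]
    | tmul p r =>
      induction r with
      | zero => simp
      | add s t hs ht => simp only [map_add, TensorProduct.tmul_add, hs, ht]
      | tmul r s => simp
  rw [h2, h3, Coalgebra.coassoc_symm_apply, ← LinearMap.lTensor_comp_rTensor]
  rfl

theorem comul_cross (y : H) (b : A) : Coalgebra.comul (R := K) (mk α 1 y * mk α b 1) =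
    Coalgebra.comul (R := K) (mk α 1 y) * Coalgebra.comul (R := K) (mk α b 1) := by
  let f : A →ₗ[K] H ⊗[K] H →ₗ[K] SmashProduct α := LinearMap.mk₂ K
    (fun b w => ofTensor α (TensorProduct.map (α.act.flip b) LinearMap.id w))
    (fun b b' w => by simp [TensorProduct.map_add_left])
    (fun k b w => by simp [TensorProduct.map_smul_left])
    (fun b w w' => by simp)
    (fun k b w => by simp)
  have hf : ∀ y b, mk α 1 y * mk α b 1 = f b (Coalgebra.comul y) := by
    intro y b
    have h1 : LinearMap.mul K A 1 ∘ₗ α.act.flip b = α.act.flip b := by ext; simp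
    have h2 : (LinearMap.mul K H).flip 1 = LinearMap.id := by ext; simp
    rw [mk_mul_mk, h1, h2]
    rfl
  let ttt := (TensorProduct.tensorTensorTensorComm K H H H H).toLinearMap
  -- swapping the two inner legs does not matter
  have hswap : ∀ (b₁ b₂ : A) (y : H),
      TensorProduct.map (f b₁) (f b₂)
        (ttt (TensorProduct.map Coalgebra.comul Coalgebra.comul (Coalgebra.comul (R := K) y))) =
      TensorProduct.map (f b₁) (f b₂)
        (TensorProduct.map Coalgebra.comul Coalgebra.comul (Coalgebra.comul (R := K) y)) := by
    intro b₁ b₂ y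
    rw [map_comul_comul]
    generalize Coalgebra.comul.lTensor H (Coalgebra.comul (R := K) y) = w
    induction w with
    | zero => simp
    | add s t hs ht => simp only [map_add, hs, ht]
    | tmul p w =>
      induction w with
      | zero => simp
      | add s t hs ht => simp only [map_add, TensorProduct.tmul_add, hs, ht]
      | tmul q t =>
        let N : H ⊗[K] A →ₗ[K] SmashProduct α ⊗[K] SmashProduct α :=
          TensorProduct.map (mkₗ α (α.act p b₁)) ((mkₗ α).flip t)
        have e1 : ∀ w : H ⊗[K] H, TensorProduct.map (f b₁) (f b₂)
            (ttt (shuffle (p ⊗ₜ[K] (w ⊗ₜ[K] t)))) =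
            N (TensorProduct.map LinearMap.id (α.act.flip b₂) (TensorProduct.comm K H H w)) := by
          intro w
          induction w with
          | zero => simp
          | add s t hs ht =>
            simp only [map_add, TensorProduct.tmul_add, TensorProduct.add_tmul, hs, ht]
          | tmul q s => simp [N, f, ttt, shuffle, mkₗ]
        have e2 : ∀ w : H ⊗[K] H, TensorProduct.map (f b₁) (f b₂)
            (shuffle (p ⊗ₜ[K] (w ⊗ₜ[K] t))) =
            N (TensorProduct.map LinearMap.id (α.act.flip b₂) w) := by
          intro w
          induction w with
          | zero => simp
          | add s t hs ht =>
            simp only [map_add, TensorProduct.tmul_add, TensorProduct.add_tmul, hs, ht]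
          | tmul q s => simp [N, f, shuffle, mkₗ]
        simp only [LinearMap.lTensor_tmul, LinearMap.rTensor_tmul]
        rw [e1, e2, α.compat]
  have hL' : ∀ (P : H ⊗[K] H) (β : A ⊗[K] A) (R : H ⊗[K] H),
      TensorProduct.map₂ (mkₗ α) (mkₗ α) (TensorProduct.map₂ α.act α.act P β) R =
        TensorProduct.map₂ f f β (ttt (P ⊗ₜ R)) := by
    intro P β R
    induction P with
    | zero => simp
    | add s t hs ht => simp only [map_add, LinearMap.add_apply, TensorProduct.add_tmul, hs, ht]
    | tmul p r =>
      induction β with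
      | zero => simp
      | add s t hs ht => simp only [map_add, LinearMap.add_apply, hs, ht]
      | tmul p' r' =>
        induction R with
        | zero => simp
        | add s t hs ht => simp only [map_add, TensorProduct.tmul_add, hs, ht]
        | tmul p'' r'' => simp [f, ttt, mkₗ]
  have hL : ∀ w : H ⊗[K] H, Coalgebra.comul (R := K) (f b w) =
      TensorProduct.map₂ f f (Coalgebra.comul b)
        (ttt (TensorProduct.map Coalgebra.comul Coalgebra.comul w)) := by
    intro w
    induction w with
    | zero => simp
    | add s t hs ht => simp only [map_add, hs, ht]
    | tmul p r =>
      rw [TensorProduct.map_tmul, ← hL', ← α.comul_act, ← comul_mk]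
      rfl
  have hR : ∀ (w : H ⊗[K] H) (β : A ⊗[K] A),
      TensorProduct.map₂ (mkₗ α) (mkₗ α) (1 ⊗ₜ 1) w *
        TensorProduct.map₂ (mkₗ α) (mkₗ α) β (1 ⊗ₜ 1) =
      TensorProduct.map₂ f f β (TensorProduct.map Coalgebra.comul Coalgebra.comul w) := by
    intro w β
    induction w with
    | zero => simp
    | add s t hs ht => simp only [map_add, add_mul, hs, ht]
    | tmul p r =>
      induction β with
      | zero => simp
      | add s t hs ht => simp only [map_add, LinearMap.add_apply, mul_add, hs, ht]
      | tmul p' r' => simp [mkₗ_apply, hf]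
  have hS : ∀ β : A ⊗[K] A, TensorProduct.map₂ f f β
        (ttt (TensorProduct.map Coalgebra.comul Coalgebra.comul (Coalgebra.comul (R := K) y))) =
      TensorProduct.map₂ f f β
        (TensorProduct.map Coalgebra.comul Coalgebra.comul (Coalgebra.comul (R := K) y)) := by
    intro β
    induction β with
    | zero => simp
    | add s t hs ht => simp only [map_add, LinearMap.add_apply, hs, ht]
    | tmul b₁ b₂ => exact hswap b₁ b₂ y
  rw [hf, hL, hS, comul_mk, comul_mk, Bialgebra.comul_one, Bialgebra.comul_one,
    Algebra.TensorProduct.one_def, Algebra.TensorProduct.one_def, hR]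

theorem comul_one' : Coalgebra.comul (R := K) (1 : SmashProduct α) = 1 := by
  rw [one_def, comul_mk, Bialgebra.comul_one, Bialgebra.comul_one,
    Algebra.TensorProduct.one_def, Algebra.TensorProduct.one_def]
  rfl

theorem comul_mul' (s t : SmashProduct α) : Coalgebra.comul (R := K) (s * t) =
    Coalgebra.comul (R := K) s * Coalgebra.comul (R := K) t := by
  have hl : ∀ (a : A) (t : SmashProduct α), Coalgebra.comul (R := K) (mk α a 1 * t) =
      Coalgebra.comul (R := K) (mk α a 1) * Coalgebra.comul (R := K) t := by
    intro a t
    induction t using SmashProduct.induction with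
    | h0 => simp
    | hadd s t hs ht => simp only [map_add, mul_add, hs, ht]
    | hmk b z => exact comul_mk_one_mul α a b z
  have hr : ∀ (z : H) (t : SmashProduct α), Coalgebra.comul (R := K) (t * mk α 1 z) =
      Coalgebra.comul (R := K) t * Coalgebra.comul (R := K) (mk α 1 z) := by
    intro z t
    induction t using SmashProduct.induction with
    | h0 => simp
    | hadd s t hs ht => simp only [map_add, add_mul, hs, ht]
    | hmk b y => exact comul_mul_mk_one α b y z
  induction s using SmashProduct.induction with
  | h0 => simp
  | hadd s t hs ht => simp only [map_add, add_mul, hs, ht]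
  | hmk a y =>
    induction t using SmashProduct.induction with
    | h0 => simp
    | hadd s t hs ht => simp only [map_add, mul_add, hs, ht]
    | hmk b z =>
      rw [mk_eq_mul α a y, mk_eq_mul α b z, mul_assoc, hl, ← mul_assoc (mk α 1 y), hr, comul_cross,
        hl, hl]
      simp only [mul_assoc]

theorem counit_one' : Coalgebra.counit (R := K) (1 : SmashProduct α) = 1 := by
  rw [one_def, counit_mk]; simp

theorem counit_mul' (s t : SmashProduct α) : Coalgebra.counit (R := K) (s * t) =
    Coalgebra.counit (R := K) s * Coalgebra.counit (R := K) t := by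
  induction s using SmashProduct.induction with
  | h0 => simp
  | hadd s t hs ht => simp only [map_add, add_mul, hs, ht]
  | hmk a y =>
    induction t using SmashProduct.induction with
    | h0 => simp
    | hadd s t hs ht => simp only [map_add, mul_add, hs, ht]
    | hmk b z =>
      have key : ∀ w : H ⊗[K] H, Coalgebra.counit (R := K) (ofTensor α
          (TensorProduct.map (LinearMap.mul K A a ∘ₗ α.act.flip b) ((LinearMap.mul K H).flip z)
            w)) = Coalgebra.counit (R := K) a * Coalgebra.counit (R := K) b *
          (Coalgebra.counit (R := K) (TensorProduct.lid K H (Coalgebra.counit.rTensor H w))) *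
            Coalgebra.counit (R := K) z := by
        intro w
        induction w with
        | zero => simp
        | add s t hs ht => simp only [map_add, mul_add, add_mul, hs, ht]
        | tmul p r =>
          change Coalgebra.counit (R := K) (mk α (a * α.act p b) (r * z)) = _
          rw [counit_mk]
          simp [α.counit_act]
          ring
      rw [mk_mul_mk, key, counit_mk, counit_mk]
      simp
      ring

noncomputable instance : Bialgebra K (SmashProduct α) :=
  Bialgebra.mk' K (SmashProduct α) (counit_one' α) (counit_mul' α _ _) (comul_one' α)
    (comul_mul' α _ _)

/-- The antipode `S(a # y) = (1 # S(y)) (S(a) # 1)`. -/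
noncomputable def antipodeAux : SmashProduct α →ₗ[K] SmashProduct α :=
  TensorProduct.lift (LinearMap.mk₂ K
    (fun (a : A) (y : H) => mk α 1 (HopfAlgebra.antipode K y) * mk α (HopfAlgebra.antipode K a) 1)
    (fun a a' y => by simp [← mkₗ_apply, mul_add])
    (fun k a y => by simp [← mkₗ_apply])
    (fun a y y' => by simp [← mkₗ_apply, add_mul])
    (fun k a y => by simp [← mkₗ_apply])) ∘ₗ (ofTensor α).symm.toLinearMap

theorem antipodeAux_mk (a : A) (y : H) : antipodeAux α (mk α a y) =
    mk α 1 (HopfAlgebra.antipode K y) * mk α (HopfAlgebra.antipode K a) 1 := by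
  simp [antipodeAux, mk]

theorem antipodeAux_left (s : SmashProduct α) :
    LinearMap.mul' K (SmashProduct α) ((antipodeAux α).rTensor (SmashProduct α)
      (Coalgebra.comul s)) = Coalgebra.counit (R := K) s • (1 : SmashProduct α) := by
  induction s using SmashProduct.induction with
  | h0 => simp
  | hadd s t hs ht => simp only [map_add, hs, ht, add_smul]
  | hmk a y =>
    have key1 : ∀ (v : A ⊗[K] A) (p r : H),
        LinearMap.mul' K (SmashProduct α) ((antipodeAux α).rTensor (SmashProduct α)
          (TensorProduct.map₂ (mkₗ α) (mkₗ α) v (p ⊗ₜ r))) =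
        mk α 1 (HopfAlgebra.antipode K p) *
          mk α (LinearMap.mul' K A ((HopfAlgebra.antipode K).rTensor A v)) 1 * mk α 1 r := by
      intro v p r
      induction v with
      | zero => simp [← mkₗ_apply]
      | add s t hs ht =>
        simp only [map_add, LinearMap.add_apply, ← mkₗ_apply, add_mul, mul_add] at hs ht ⊢
        rw [hs, ht]
      | tmul b c =>
        simp only [TensorProduct.map₂_apply_tmul, TensorProduct.map_tmul, mkₗ_apply,
          LinearMap.rTensor_tmul, LinearMap.mul'_apply, antipodeAux_mk, mul_assoc, mk_one_mul_mk,
          mul_one]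
    have key2 : ∀ w : H ⊗[K] H,
        LinearMap.mul' K (SmashProduct α) ((antipodeAux α).rTensor (SmashProduct α)
          (TensorProduct.map₂ (mkₗ α) (mkₗ α) (Coalgebra.comul a) w)) =
        Coalgebra.counit (R := K) a •
          mk α 1 (LinearMap.mul' K H ((HopfAlgebra.antipode K).rTensor H w)) := by
      intro w
      induction w with
      | zero => simp [← mkₗ_apply]
      | add s t hs ht =>
        simp only [map_add, ← mkₗ_apply, smul_add] at hs ht ⊢
        rw [hs, ht]
      | tmul p r =>
        rw [key1, HopfAlgebra.mul_antipode_rTensor_comul_apply, Algebra.algebraMap_eq_smul_one,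
          ← mkₗ_apply α (_ • _), map_smul, LinearMap.smul_apply, mkₗ_apply, ← one_def,
          mul_smul_comm, mul_one, smul_mul_assoc, mk_mul_mk_one]
        simp
    rw [comul_mk, key2, HopfAlgebra.mul_antipode_rTensor_comul_apply,
      Algebra.algebraMap_eq_smul_one, ← mkₗ_apply, map_smul, mkₗ_apply, ← one_def, counit_mk,
      smul_smul]

theorem antipodeAux_right (s : SmashProduct α) :
    LinearMap.mul' K (SmashProduct α) ((antipodeAux α).lTensor (SmashProduct α)
      (Coalgebra.comul s)) = Coalgebra.counit (R := K) s • (1 : SmashProduct α) := by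
  induction s using SmashProduct.induction with
  | h0 => simp
  | hadd s t hs ht => simp only [map_add, hs, ht, add_smul]
  | hmk a y =>
    have key1 : ∀ (w : H ⊗[K] H) (p r : A),
        LinearMap.mul' K (SmashProduct α) ((antipodeAux α).lTensor (SmashProduct α)
          (TensorProduct.map₂ (mkₗ α) (mkₗ α) (p ⊗ₜ r) w)) =
        mk α p 1 * mk α 1 (LinearMap.mul' K H ((HopfAlgebra.antipode K).lTensor H w)) *
          mk α (HopfAlgebra.antipode K r) 1 := by
      intro w p r
      induction w with
      | zero => simp [← mkₗ_apply]
      | add s t hs ht =>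
        simp only [map_add, ← mkₗ_apply, add_mul, mul_add] at hs ht ⊢
        rw [hs, ht]
      | tmul b c =>
        simp only [TensorProduct.map₂_apply_tmul, TensorProduct.map_tmul, mkₗ_apply,
          LinearMap.lTensor_tmul, LinearMap.mul'_apply, antipodeAux_mk, ← mul_assoc, mk_mul_mk_one,
          one_mul]
    have key2 : ∀ v : A ⊗[K] A,
        LinearMap.mul' K (SmashProduct α) ((antipodeAux α).lTensor (SmashProduct α)
          (TensorProduct.map₂ (mkₗ α) (mkₗ α) v (Coalgebra.comul y))) =
        Coalgebra.counit (R := K) y •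
          mk α (LinearMap.mul' K A ((HopfAlgebra.antipode K).lTensor A v)) 1 := by
      intro v
      induction v with
      | zero => simp [← mkₗ_apply]
      | add s t hs ht =>
        simp only [map_add, LinearMap.add_apply, ← mkₗ_apply, smul_add] at hs ht ⊢
        rw [hs, ht]
      | tmul p r =>
        rw [key1, HopfAlgebra.mul_antipode_lTensor_comul_apply, Algebra.algebraMap_eq_smul_one,
          ← mkₗ_apply α _ (_ • _), map_smul, mkₗ_apply, ← one_def,
          mul_smul_comm, mul_one, smul_mul_assoc, mk_one_mul_mk]
        simp
    rw [comul_mk, key2, HopfAlgebra.mul_antipode_lTensor_comul_apply,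
      Algebra.algebraMap_eq_smul_one, ← mkₗ_apply, map_smul, LinearMap.smul_apply, mkₗ_apply,
      ← one_def, counit_mk, smul_smul, mul_comm]

/-- The smash product Hopf algebra. -/
noncomputable instance : HopfAlgebra K (SmashProduct α) where
  antipode := antipodeAux α
  mul_antipode_rTensor_comul := by
    ext s
    simpa [Algebra.algebraMap_eq_smul_one] using antipodeAux_left α s
  mul_antipode_lTensor_comul := by
    ext s
    simpa [Algebra.algebraMap_eq_smul_one] using antipodeAux_right α s

/-- The map `ε ⊗ id : A # H → H`, `a # y ↦ ε(a) y`. -/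
noncomputable def projRight : SmashProduct α →ₗ[K] H :=
  (TensorProduct.lid K H).toLinearMap ∘ₗ (Coalgebra.counit (R := K) (A := A)).rTensor H ∘ₗ
    (ofTensor α).symm.toLinearMap

theorem projRight_mk (a : A) (y : H) :
    projRight α (mk α a y) = Coalgebra.counit (R := K) a • y := by
  simp [projRight, mk]

end SmashProduct
end

/-! An isomorphism of Hopf algebras preserves group-like and skew-primitive elements, and in `T #
K[G]` these are few. As a coalgebra, the smash product is `T ⊗ K[G]` whatever the action, so both
kinds can be found by comparing coefficients in the basis `h ^ i x ^ j # g`, `j < m`. The regular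
representation shows that this is a basis, and the Gaussian binomial formula gives its
comultiplication.

The group-like elements are the `h ^ i # g` (`exists_eq_mk_of_isGroupLikeElem`). So `φ (h # 1) = h ^
e # g`, and `y = φ (x # 1)` satisfies `Δ y = y ⊗ (h ^ e # g) + 1 ⊗ y`. Such a `y` has degree at most
one in `x`. Its degree-one part is nonzero: otherwise `y` would lie in the span of the group-likes,
and so would `x # 1`. A nonzero degree-one part forces `e = 1`, `g = 1` and `y = (c x + a + b h) #
1`. The relation `x h = q h x`, with `q ≠ 1` and `h` invertible, then kills `a + b h`
(`exists_bialgEquiv_h_x`). Hence `φ` carries `T # 1` into `T # 1` by a rescaling `u` of `x`, and `p`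
is trivial.

Finally `φ (1 # g) = h ^ ρ g # σ g`. The map `ε ⊗ id` is multiplicative, so `σ` is a homomorphism;
it is bijective because `φ` fixes every `h ^ n # 1`. With `r g = h ^ ρ g` and `v` induced by `σ`,
the formula is `φ (a # g) = φ (a # 1) φ (1 # g)`. -/

theorem pow_zmodVal_natCast {M : Type*} [Monoid M] {m : ℕ} {c : M} (hc : c ^ m = 1) (n : ℕ) :
    c ^ (n : ZMod m).val = c ^ n := by
  rw [ZMod.val_natCast, ← pow_eq_pow_mod n hc]

theorem pow_zmodVal_add_one {M : Type*} [Monoid M] {m : ℕ} [NeZero m] {c : M} (hc : c ^ m = 1)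
    (i : ZMod m) : c ^ (i + 1).val = c * c ^ i.val := by
  rw [← pow_succ', ← pow_zmodVal_natCast hc (i.val + 1)]
  simp

/-! ### The monomial basis of the Taft algebra and its comultiplication -/

namespace TaftAlgebra
variable {K : Type*} [Field K] {m : ℕ} {q : K}

/-- By `qBinom_mul` at `k = 0`, `(q - 1)` times this coefficient is `q ^ n - 1`, which is nonzero by
primitivity. This is what excludes powers `x ^ j`, `j ≥ 2`, from skew-primitive elements. -/
theorem qBinom_one_ne_zero (hq : IsPrimitiveRoot q m) {n : ℕ} (h1 : 0 < n) (h2 : n < m) :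
    qBinom q n 1 ≠ 0 := by
  intro h
  have := qBinom_mul q n 0
  simp only [h, qBinom, pow_zero, zero_add, mul_zero, mul_one] at this
  exact hq.pow_ne_one_of_pos_of_lt h1.ne' h2 (sub_eq_zero.1 this.symm)

/-- The operator `e (i, j) ↦ e (i + 1, j)`, by which `h` acts in the regular representation. -/
noncomputable def shiftLeft (K : Type*) [Field K] (m : ℕ) :
    Module.End K (ZMod m × ℕ →₀ K) :=
  Finsupp.lmapDomain K K fun p => (p.1 + 1, p.2)

/-- The operator `e (i, j) ↦ q ^ i e (i, j + 1)`, truncated at `j + 1 = m`, by which `x` acts in the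
regular representation. -/
noncomputable def shiftRight (m : ℕ) (q : K) : Module.End K (ZMod m × ℕ →₀ K) :=
  Finsupp.linearCombination K fun p =>
    if p.2 + 1 < m then Finsupp.single (p.1, p.2 + 1) (q ^ p.1.val) else 0

theorem shiftLeft_single (i : ZMod m) (j : ℕ) (c : K) :
    shiftLeft K m (Finsupp.single (i, j) c) = Finsupp.single (i + 1, j) c := by
  simp [shiftLeft, Finsupp.mapDomain_single]

theorem shiftLeft_pow_single (n : ℕ) (i : ZMod m) (j : ℕ) (c : K) :
    (shiftLeft K m ^ n) (Finsupp.single (i, j) c) = Finsupp.single (i + n, j) c := by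
  induction n generalizing i with
  | zero => simp
  | succ n ih =>
    rw [pow_succ, Module.End.mul_apply, shiftLeft_single, ih]
    push_cast
    rw [add_assoc, add_comm (1 : ZMod m)]

theorem shiftRight_single (i : ZMod m) (j : ℕ) (c : K) :
    shiftRight m q (Finsupp.single (i, j) c) =
      if j + 1 < m then Finsupp.single (i, j + 1) (c * q ^ i.val) else 0 := by
  simp [shiftRight]

theorem shiftRight_pow_single_zero (n : ℕ) (hn : n < m) :
    (shiftRight m q ^ n) (Finsupp.single (0, 0) 1) = Finsupp.single (0, n) 1 := by
  induction n with
  | zero => simp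
  | succ n ih =>
    rw [pow_succ', Module.End.mul_apply, ih (by omega), shiftRight_single, if_pos hn]
    simp

/-- The index `j` runs over all of `ℕ`, so there are superfluous basis vectors with `j ≥ m`. One
application of the operator kills them, but the zeroth power does not, whence `0 < n`. -/
theorem shiftRight_pow_single_of_le (n : ℕ) (hn : 0 < n) (i : ZMod m) (j : ℕ) (h : m ≤ j + n)
    (c : K) : (shiftRight m q ^ n) (Finsupp.single (i, j) c) = 0 := by
  induction n generalizing j c with
  | zero => omega
  | succ n ih =>
    rw [pow_succ, Module.End.mul_apply, shiftRight_single]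
    split_ifs with h1
    · exact ih (by omega) _ (by omega) _
    · simp

variable (hm : 2 ≤ m) (hq : IsPrimitiveRoot q m)

/-- The regular representation in terms of the monomials `h ^ i * x ^ j`. -/
noncomputable def regularRep : TaftAlgebra hm hq →ₐ[K] Module.End K (ZMod m × ℕ →₀ K) :=
  lift hm hq (shiftLeft K m) (shiftRight m q)
    (by
      ext1 ⟨i, j⟩
      ext1
      simp [shiftLeft_pow_single])
    (by
      ext1 ⟨i, j⟩
      ext1
      simp [shiftRight_pow_single_of_le m (by omega : 0 < m) i j (by omega)])
    (by
      have : NeZero m := ⟨by omega⟩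
      ext1 ⟨i, j⟩
      ext1
      -- The representative of `i + 1` may wrap around to `0`; since `q ^ m = 1`, the factor `q ^ (i
      -- + 1).val` is still `q * q ^ i.val`.
      simp only [LinearMap.comp_apply, Finsupp.lsingle_apply, Module.End.mul_apply,
        LinearMap.smul_apply, shiftLeft_single, shiftRight_single,
        pow_zmodVal_add_one hq.pow_eq_one]
      split_ifs
      · simp [shiftLeft_single]
      · simp)

/-- The coordinates with respect to the monomials `h ^ i * x ^ j`. -/
noncomputable def coord : TaftAlgebra hm hq →ₗ[K] ZMod m × ℕ →₀ K :=
  LinearMap.applyₗ (Finsupp.single (0, 0) 1) ∘ₗ (regularRep hm hq).toLinearMap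

/-- The monomial `h ^ i * x ^ j`. -/
noncomputable def monomial (p : ZMod m × ℕ) : TaftAlgebra hm hq := h hm hq ^ p.1.val * x hm hq ^ p.2

theorem monomial_of_le (i : ZMod m) {j : ℕ} (hj : m ≤ j) : monomial hm hq (i, j) = 0 := by
  rw [monomial, pow_eq_zero_of_le hj (x_pow hm hq), mul_zero]

theorem h_mul_monomial (i : ZMod m) (j : ℕ) :
    h hm hq * monomial hm hq (i, j) = monomial hm hq (i + 1, j) := by
  have : NeZero m := ⟨by omega⟩
  rw [monomial, monomial, pow_zmodVal_add_one (h_pow hm hq), mul_assoc]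

theorem x_mul_monomial (i : ZMod m) (j : ℕ) :
    x hm hq * monomial hm hq (i, j) = q ^ i.val • monomial hm hq (i, j + 1) := by
  rw [monomial, monomial, ← mul_assoc, mul_pow_of_skew (x_mul_h hm hq), smul_mul_assoc, mul_assoc,
    ← pow_succ']

/-- Sending basis vectors to monomials intertwines the representation with left multiplication; it
suffices to check the generators. The truncation at `j + 1 = m` matches `x ^ m = 0`. Evaluated at
the vector of index `(0, 0)`, which goes to `1`, this shows that the monomials span. -/
theorem linearCombination_monomial_regularRep (a : TaftAlgebra hm hq) (v : ZMod m × ℕ →₀ K) :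
    Finsupp.linearCombination K (monomial hm hq) (regularRep hm hq a v) =
      a * Finsupp.linearCombination K (monomial hm hq) v := by
  induction a using TaftAlgebra.induction generalizing v with
  | hc c => simp [Algebra.algebraMap_eq_smul_one]
  | hh =>
    induction v using Finsupp.induction_linear with
    | zero => simp
    | add v w hv hw => simp only [map_add, mul_add, hv, hw]
    | single p c =>
      obtain ⟨i, j⟩ := p
      rw [regularRep, lift_h, shiftLeft_single]
      simp [h_mul_monomial]
  | hx =>
    induction v using Finsupp.induction_linear with
    | zero => simp
    | add v w hv hw => simp only [map_add, mul_add, hv, hw]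
    | single p c =>
      obtain ⟨i, j⟩ := p
      rw [regularRep, lift_x, shiftRight_single]
      split_ifs with hp
      · simp only [Finsupp.linearCombination_single, mul_smul_comm, x_mul_monomial, smul_smul]
      · simp [x_mul_monomial, monomial_of_le hm hq i (not_lt.1 hp)]
  | hadd a b ha hb => simp only [map_add, LinearMap.add_apply, add_mul, ha, hb]
  | hmul a b ha hb => rw [map_mul, Module.End.mul_apply, ha, hb, mul_assoc]

theorem linearCombination_coord (a : TaftAlgebra hm hq) :
    Finsupp.linearCombination K (monomial hm hq) (coord hm hq a) = a := by
  simp [coord, linearCombination_monomial_regularRep, monomial]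

/-- The linear independence of the monomials with `j < m`: applied to the vector of index `(0, 0)`,
they give distinct basis vectors. -/
theorem coord_monomial (p : ZMod m × ℕ) (hp : p.2 < m) :
    coord hm hq (monomial hm hq p) = Finsupp.single p 1 := by
  have : NeZero m := ⟨by omega⟩
  simp only [coord, monomial, LinearMap.comp_apply, AlgHom.toLinearMap_apply, map_mul, map_pow,
    LinearMap.applyₗ_apply_apply, Module.End.mul_apply]
  rw [regularRep, lift_h, lift_x, shiftRight_pow_single_zero _ hp, shiftLeft_pow_single]
  simp

theorem monomial_induction {P : TaftAlgebra hm hq → Prop} (h0 : P 0)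
    (hadd : ∀ a b, P a → P b → P (a + b)) (hsmul : ∀ (c : K) a, P a → P (c • a))
    (hmon : ∀ p : ZMod m × ℕ, p.2 < m → P (monomial hm hq p)) (a : TaftAlgebra hm hq) : P a := by
  rw [← linearCombination_coord hm hq a]
  induction coord hm hq a using Finsupp.induction_linear with
  | zero => simpa using h0
  | add v w hv hw => rw [map_add]; exact hadd _ _ hv hw
  | single p c =>
    rw [Finsupp.linearCombination_single]
    rcases lt_or_ge p.2 m with hp | hp
    · exact hsmul _ _ (hmon p hp)
    · rw [monomial_of_le hm hq p.1 hp, smul_zero]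
      exact h0

theorem coord_of_le (a : TaftAlgebra hm hq) (i : ZMod m) {j : ℕ} (hj : m ≤ j) :
    coord hm hq a (i, j) = 0 := by
  induction a using monomial_induction with
  | h0 => simp
  | hadd a b ha hb => simp [ha, hb]
  | hsmul c a ha => simp [ha]
  | hmon p hp =>
    rw [coord_monomial hm hq p hp, Finsupp.single_apply, if_neg]
    rintro rfl
    exact absurd hp (not_lt.2 hj)

/-- With `X = x ⊗ h` and `Y = 1 ⊗ x` one has `Y X = q X Y`, so `Δ (x ^ n) = (X + Y) ^ n` expands by
the Gaussian binomial formula. The factor `h ^ k` from `X ^ k` shifts the exponent of `h` in the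
second leg. -/
theorem comul_monomial (i : ZMod m) (n : ℕ) :
    Coalgebra.comul (R := K) (monomial hm hq (i, n)) = ∑ k ∈ Finset.range (n + 1),
      qBinom q n k • (monomial hm hq (i, k) ⊗ₜ monomial hm hq (i + k, n - k)) := by
  have : NeZero m := ⟨by omega⟩
  have hk (k : ℕ) : h hm hq ^ (i + k).val = h hm hq ^ i.val * h hm hq ^ k := by
    rw [← pow_add, ← pow_zmodVal_natCast (h_pow hm hq) (i.val + k)]
    simp
  rw [monomial, Bialgebra.comul_mul, Bialgebra.comul_pow, Bialgebra.comul_pow, comul_h, comul_x,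
    add_pow_of_skew (q := q) (by simp [x_mul_h]), Finset.mul_sum]
  refine Finset.sum_congr rfl fun k _ => ?_
  simp [monomial, hk, mul_assoc]

/-- The convolution product of two coordinate functionals. -/
theorem coord_comul (a : TaftAlgebra hm hq) (i i' : ZMod m) (j j' : ℕ) :
    TensorProduct.lid K K (TensorProduct.map (Finsupp.lapply (i, j) ∘ₗ coord hm hq)
      (Finsupp.lapply (i', j') ∘ₗ coord hm hq) (Coalgebra.comul (R := K) a)) =
    if i' = i + j then qBinom q (j + j') j * coord hm hq a (i, j + j') else 0 := by
  induction a using monomial_induction with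
  | h0 => simp
  | hadd a b ha hb => simp only [map_add, ha, hb]; split_ifs <;> simp [mul_add]
  | hsmul c a ha => simp only [map_smul, ha]; split_ifs <;> simp [mul_left_comm]
  | hmon p hp =>
    obtain ⟨k, n⟩ := p
    simp only at hp
    rw [comul_monomial, coord_monomial hm hq _ hp, map_sum, map_sum]
    -- The first functional sees only `x`-degree `j` in the first leg, so at most the summand `l =
    -- j` survives.
    have e : ∀ l ∈ Finset.range (n + 1), TensorProduct.lid K K
        (TensorProduct.map (Finsupp.lapply (i, j) ∘ₗ coord hm hq)
          (Finsupp.lapply (i', j') ∘ₗ coord hm hq) (qBinom q n l •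
            (monomial hm hq (k, l) ⊗ₜ monomial hm hq (k + l, n - l)))) =
        if l = j then (if k = i ∧ k + l = i' ∧ n - l = j' then qBinom q n l else 0) else 0 := by
      intro l hl
      have hl' := Finset.mem_range.1 hl
      simp only [map_smul, TensorProduct.map_tmul, LinearMap.comp_apply,
        coord_monomial hm hq (k, l) (by simp only; omega),
        coord_monomial hm hq (k + l, n - l) (by simp only; omega), Finsupp.lapply_apply,
        TensorProduct.lid_tmul, Finsupp.single_apply, Prod.mk.injEq, smul_eq_mul]
      split_ifs <;> grind
    rw [Finset.sum_congr rfl e, Finset.sum_ite_eq', Finsupp.single_apply]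
    simp only [Finset.mem_range, Prod.mk.injEq]
    split_ifs <;> grind

end TaftAlgebra

/-! ### Coordinates and group-like elements of the smash product -/

namespace SmashProduct
variable {K : Type*} [Field K] {m : ℕ} {q : K} {hm : 2 ≤ m} {hq : IsPrimitiveRoot q m}
  {G : Type*} [Group G] (α : SmashAction K (TaftAlgebra hm hq) (MonoidAlgebra K G))

theorem taft_induction {P : SmashProduct α → Prop} (h0 : P 0)
    (hadd : ∀ s t, P s → P t → P (s + t)) (hsmul : ∀ (c : K) s, P s → P (c • s))
    (hmk : ∀ a g, P (mk α a (MonoidAlgebra.single g 1))) (s : SmashProduct α) : P s := by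
  induction s using SmashProduct.induction with
  | h0 => exact h0
  | hadd s t hs ht => exact hadd s t hs ht
  | hmk a y =>
    induction y using MonoidAlgebra.induction_linear with
    | zero => rw [← mkₗ_apply, map_zero]; exact h0
    | add y z hy hz => rw [← mkₗ_apply, map_add]; exact hadd _ _ hy hz
    | single g c =>
      have : MonoidAlgebra.single g c = c • MonoidAlgebra.single g (1 : K) := by simp
      rw [this, ← mkₗ_apply, map_smul]
      exact hsmul _ _ (hmk a g)

/-- The coordinates with respect to the elements `h ^ i * x ^ j # g`. -/
noncomputable def taftCoord : SmashProduct α →ₗ[K] (ZMod m × ℕ) × G →₀ K :=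
  (finsuppTensorFinsupp' K (ZMod m × ℕ) G).toLinearMap ∘ₗ
    TensorProduct.map (TaftAlgebra.coord hm hq)
      (MonoidAlgebra.coeffLinearEquiv K).toLinearMap ∘ₗ
    (ofTensor α).symm.toLinearMap

theorem taftCoord_mk (a : TaftAlgebra hm hq) (g : G) (p : ZMod m × ℕ) (s : G) :
    taftCoord α (mk α a (MonoidAlgebra.single g 1)) (p, s) =
      TaftAlgebra.coord hm hq a p * Finsupp.single g (1 : K) s := by
  simp [taftCoord, mk]

theorem linearCombination_taftCoord (y : SmashProduct α) :
    Finsupp.linearCombination K (fun p : (ZMod m × ℕ) × G =>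
      mk α (TaftAlgebra.monomial hm hq p.1) (MonoidAlgebra.single p.2 1)) (taftCoord α y) = y := by
  induction y using taft_induction with
  | h0 => simp
  | hadd s t hs ht => simp only [map_add, hs, ht]
  | hsmul c s hs => simp only [map_smul, hs]
  | hmk a g =>
    induction a using TaftAlgebra.monomial_induction with
    | h0 => simp [← mkₗ_apply]
    | hadd s t hs ht => simp only [← mkₗ_apply, map_add, LinearMap.add_apply] at hs ht ⊢; rw [hs, ht]
    | hsmul c s hs => simp only [← mkₗ_apply, map_smul, LinearMap.smul_apply] at hs ⊢; rw [hs]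
    | hmon p hp =>
      have : taftCoord α (mk α (TaftAlgebra.monomial hm hq p) (MonoidAlgebra.single g 1)) =
          Finsupp.single (p, g) 1 := by
        simp [taftCoord, mk, TaftAlgebra.coord_monomial hm hq p hp]
      rw [this]
      simp

theorem taftCoord_of_le (y : SmashProduct α) (i : ZMod m) {j : ℕ} (hj : m ≤ j) (s : G) :
    taftCoord α y ((i, j), s) = 0 := by
  induction y using taft_induction with
  | h0 => simp
  | hadd a b ha hb => simp [ha, hb]
  | hsmul c a ha => simp [ha]
  | hmk a g => rw [taftCoord_mk, TaftAlgebra.coord_of_le hm hq a i hj, zero_mul]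

open scoped Classical in
/-- The convolution product of two coordinate functionals. -/
theorem taftCoord_comul (y : SmashProduct α) (i i' : ZMod m) (j j' : ℕ) (s t : G) :
    TensorProduct.lid K K (TensorProduct.map (Finsupp.lapply ((i, j), s) ∘ₗ taftCoord α)
      (Finsupp.lapply ((i', j'), t) ∘ₗ taftCoord α) (Coalgebra.comul (R := K) y)) =
    if s = t ∧ i' = i + j then
      TaftAlgebra.qBinom q (j + j') j * taftCoord α y ((i, j + j'), s) else 0 := by
  induction y using taft_induction with
  | h0 => simp
  | hadd a b ha hb => simp only [map_add, ha, hb]; split_ifs <;> simp [mul_add]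
  | hsmul c a ha => simp only [map_smul, ha]; split_ifs <;> simp [mul_left_comm]
  | hmk a g =>
    have key : ∀ w : TaftAlgebra hm hq ⊗[K] TaftAlgebra hm hq,
        TensorProduct.lid K K (TensorProduct.map (Finsupp.lapply ((i, j), s) ∘ₗ taftCoord α)
          (Finsupp.lapply ((i', j'), t) ∘ₗ taftCoord α) (TensorProduct.map₂ (mkₗ α) (mkₗ α) w
            (MonoidAlgebra.single g 1 ⊗ₜ MonoidAlgebra.single g 1))) =
        TensorProduct.lid K K (TensorProduct.map
          (Finsupp.lapply (i, j) ∘ₗ TaftAlgebra.coord hm hq)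
          (Finsupp.lapply (i', j') ∘ₗ TaftAlgebra.coord hm hq) w) *
          (Finsupp.single g (1 : K) s * Finsupp.single g (1 : K) t) := by
      intro w
      induction w with
      | zero => simp
      | add v w hv hw => simp only [map_add, LinearMap.add_apply, hv, hw, add_mul]
      | tmul b c => simp [mkₗ_apply, taftCoord_mk]; ring
    have hg : Coalgebra.comul (R := K) (MonoidAlgebra.single g (1 : K)) =
      MonoidAlgebra.single g (1 : K) ⊗ₜ MonoidAlgebra.single g (1 : K) := by simp
    rw [comul_mk, hg, key, TaftAlgebra.coord_comul, taftCoord_mk]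
    simp only [Finsupp.single_apply]
    split_ifs <;> grind

/-- For group-like `y`, the convolution formula `taftCoord_comul` expresses products of two
coefficients of `y`. It makes the coefficients of positive `x`-degree square to zero and those of
degree zero orthogonal idempotents of `K`, so exactly one coefficient is nonzero and it equals `1`.
-/
theorem exists_eq_mk_of_isGroupLikeElem {y : SmashProduct α} (hy : IsGroupLikeElem K y) :
    ∃ (i : ZMod m) (g : G), y = mk α (TaftAlgebra.h hm hq ^ i.val) (MonoidAlgebra.single g 1) := by
  classical
  have hc (i i' : ZMod m) (j j' : ℕ) (s t : G) :
      taftCoord α y ((i, j), s) * taftCoord α y ((i', j'), t) =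
      if s = t ∧ i' = i + j then
        TaftAlgebra.qBinom q (j + j') j * taftCoord α y ((i, j + j'), s) else 0 := by
    rw [← taftCoord_comul, hy.comul_eq_tmul_self]
    simp
  -- The square of this coefficient could be nonzero only if `i = i + j` in `ZMod m`, that is `m ∣
  -- j`, which is impossible for `0 < j < m`.
  have h0 (i : ZMod m) (j : ℕ) (hj : 0 < j) (s : G) : taftCoord α y ((i, j), s) = 0 := by
    rcases lt_or_ge j m with h1 | h1
    · have := hc i i j j s s
      rwa [if_neg, mul_self_eq_zero] at this
      rintro ⟨-, h⟩
      have h2 : (j : ZMod m) = 0 := by simpa using h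
      rw [ZMod.natCast_eq_zero_iff] at h2
      exact absurd (Nat.le_of_dvd hj h2) (not_le.2 h1)
    · exact taftCoord_of_le α y i h1 s
  obtain ⟨⟨⟨i, j⟩, g⟩, hne⟩ : ∃ p, taftCoord α y p ≠ 0 := by
    by_contra! h
    have h1 := linearCombination_taftCoord α y
    rw [Finsupp.ext (g := 0) h, map_zero] at h1
    have := hy.counit_eq_one
    simp [← h1] at this
  obtain rfl : j = 0 := by
    by_contra h
    exact hne (h0 i j (Nat.pos_of_ne_zero h) g)
  have hone : taftCoord α y ((i, 0), g) = 1 := by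
    have := hc i i 0 0 g g
    simp only [Nat.cast_zero, add_zero, and_self, if_true, TaftAlgebra.qBinom, one_mul] at this
    exact mul_left_cancel₀ hne (by rw [this, mul_one])
  have hs : taftCoord α y = Finsupp.single ((i, 0), g) 1 := by
    ext ⟨⟨i', j⟩, t⟩
    rcases Nat.eq_zero_or_pos j with rfl | hj
    · have := hc i i' 0 0 g t
      rw [hone, one_mul] at this
      rw [this, Finsupp.single_apply]
      simp only [TaftAlgebra.qBinom, Nat.cast_zero, add_zero, mul_one, Prod.mk.injEq, and_true]
      split_ifs <;> grind
    · rw [h0 i' j hj t, Finsupp.single_apply, if_neg]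
      simp only [Prod.mk.injEq]
      omega
  refine ⟨i, g, ?_⟩
  rw [← linearCombination_taftCoord α y, hs]
  simp [TaftAlgebra.monomial]

theorem isGroupLikeElem_mk {a : TaftAlgebra hm hq} (ha : IsGroupLikeElem K a) (g : G) :
    IsGroupLikeElem K (mk α a (MonoidAlgebra.single g 1)) where
  counit_eq_one := by simp [counit_mk, ha.counit_eq_one]
  comul_eq_tmul_self := by
    rw [comul_mk, ha.comul_eq_tmul_self]
    simp [mkₗ_apply]

theorem isGroupLikeElem_h_pow (n : ℕ) : IsGroupLikeElem K (TaftAlgebra.h hm hq ^ n) :=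
  IsGroupLikeElem.pow ⟨TaftAlgebra.counit_h hm hq, TaftAlgebra.comul_h hm hq⟩

end SmashProduct

/-! ### Skew-primitive elements and the images of `h` and `x` -/

namespace SmashProduct
variable {K : Type*} [Field K] {m : ℕ} {q : K} {hm : 2 ≤ m} {hq : IsPrimitiveRoot q m}
  {G : Type*} [Group G] (α : SmashAction K (TaftAlgebra hm hq) (MonoidAlgebra K G))

open scoped Classical in
theorem taftCoord_h_pow (e i : ZMod m) (j : ℕ) (g s : G) :
    taftCoord α (mk α (TaftAlgebra.h hm hq ^ e.val) (MonoidAlgebra.single g 1)) ((i, j), s) =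
      if i = e ∧ j = 0 ∧ s = g then 1 else 0 := by
  have := TaftAlgebra.coord_monomial hm hq (e, 0) (by simp only; omega)
  simp only [TaftAlgebra.monomial, pow_zero, mul_one] at this
  rw [taftCoord_mk, this]
  simp only [Finsupp.single_apply, Prod.mk.injEq]
  split_ifs <;> grind

/-- Together with `mem_span_isGroupLikeElem`, this identifies the span of the group-like elements,
which a bialgebra isomorphism preserves, with the part of `x`-degree zero. -/
theorem taftCoord_eq_zero_of_mem_span {y : SmashProduct α}
    (hy : y ∈ Submodule.span K {z : SmashProduct α | IsGroupLikeElem K z}) (i : ZMod m) {j : ℕ}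
    (hj : 0 < j) (s : G) : taftCoord α y ((i, j), s) = 0 := by
  induction hy using Submodule.span_induction with
  | mem z hz =>
    obtain ⟨e, g, rfl⟩ := exists_eq_mk_of_isGroupLikeElem α hz
    rw [taftCoord_h_pow, if_neg (by omega)]
  | zero => simp
  | add y z _ _ hy hz => simp [hy, hz]
  | smul c y _ hy => simp [hy]

theorem mem_span_isGroupLikeElem {y : SmashProduct α}
    (hy : ∀ (i : ZMod m) (j : ℕ), 0 < j → ∀ s, taftCoord α y ((i, j), s) = 0) :
    y ∈ Submodule.span K {z : SmashProduct α | IsGroupLikeElem K z} := by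
  rw [← linearCombination_taftCoord α y, Finsupp.linearCombination_apply]
  refine Submodule.sum_mem _ fun ⟨⟨i, j⟩, g⟩ hp => Submodule.smul_mem _ _ (Submodule.subset_span ?_)
  obtain rfl : j = 0 := by
    by_contra h
    exact Finsupp.mem_support_iff.1 hp (hy i j (Nat.pos_of_ne_zero h) g)
  simp only [TaftAlgebra.monomial, pow_zero, mul_one]
  exact isGroupLikeElem_mk α (isGroupLikeElem_h_pow _) g

section SkewPrimitive
variable {α} {y : SmashProduct α} {e : ZMod m} {g : G}

open scoped Classical in
-- Both sides are the coefficient of `(h ^ i x ^ j # s) ⊗ (h ^ i' x ^ j' # t)` in `Δ y`: the left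
-- one by the general formula, the right one by skew-primitivity. The next lemmas specialise the
-- indices.
theorem taftCoord_of_skewPrimitive
    (hy : Coalgebra.comul (R := K) y =
      y ⊗ₜ mk α (TaftAlgebra.h hm hq ^ e.val) (MonoidAlgebra.single g 1) + 1 ⊗ₜ y)
    (i i' : ZMod m) (j j' : ℕ) (s t : G) :
    (if s = t ∧ i' = i + j then
      TaftAlgebra.qBinom q (j + j') j * taftCoord α y ((i, j + j'), s) else 0) =
    (if i' = e ∧ j' = 0 ∧ t = g then taftCoord α y ((i, j), s) else 0) +
      if i = 0 ∧ j = 0 ∧ s = 1 then taftCoord α y ((i', j'), t) else 0 := by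
  have h1 : (1 : SmashProduct α) =
      mk α (TaftAlgebra.h hm hq ^ (0 : ZMod m).val) (MonoidAlgebra.single 1 1) := by
    rw [one_def, MonoidAlgebra.one_def, ZMod.val_zero, pow_zero]
  rw [← taftCoord_comul, hy, h1]
  simp only [map_add, TensorProduct.map_tmul, LinearMap.comp_apply, Finsupp.lapply_apply,
    TensorProduct.lid_tmul, taftCoord_h_pow, smul_eq_mul, mul_ite, mul_one, mul_zero, ite_mul,
    one_mul, zero_mul]

theorem taftCoord_skewPrimitive_of_two_le
    (hy : Coalgebra.comul (R := K) y =
      y ⊗ₜ mk α (TaftAlgebra.h hm hq ^ e.val) (MonoidAlgebra.single g 1) + 1 ⊗ₜ y)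
    (i : ZMod m) {j : ℕ} (hj : 2 ≤ j) (s : G) :
    taftCoord α y ((i, j), s) = 0 := by
  rcases lt_or_ge j m with h1 | h1
  · obtain ⟨j, rfl⟩ : ∃ k, j = 1 + k := ⟨j - 1, by omega⟩
    -- Splitting off one factor `x` leaves positive `x`-degree in both legs, whereas each term of `y
    -- ⊗ (h ^ e # g) + 1 ⊗ y` has degree zero in some leg.
    have := taftCoord_of_skewPrimitive hy i (i + (1 : ℕ)) 1 j s s
    rw [if_pos ⟨rfl, rfl⟩, if_neg (by omega), if_neg (by omega), add_zero] at this
    exact (mul_eq_zero.1 this).resolve_left (TaftAlgebra.qBinom_one_ne_zero hq (by omega) h1)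
  · exact taftCoord_of_le α y i h1 s

/-- Splitting the degree as `0 + 1` involves only the term `1 ⊗ y` and forces `i = 0`, `s = 1`.
Splitting it as `1 + 0` involves only `y ⊗ (h ^ e # g)` and forces `i + 1 = e`, `s = g`. -/
theorem eq_of_taftCoord_skewPrimitive_one_ne_zero
    (hy : Coalgebra.comul (R := K) y =
      y ⊗ₜ mk α (TaftAlgebra.h hm hq ^ e.val) (MonoidAlgebra.single g 1) + 1 ⊗ₜ y)
    {i : ZMod m} {s : G}
    (hs : taftCoord α y ((i, 1), s) ≠ 0) : (i = 0 ∧ s = 1) ∧ e = 1 ∧ g = 1 := by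
  have h1 := taftCoord_of_skewPrimitive hy i i 0 1 s s
  have h2 := taftCoord_of_skewPrimitive hy i (i + 1) 1 0 s s
  rw [if_pos (by simp), if_neg (by omega)] at h1
  rw [if_pos (by simp)] at h2
  simp only [TaftAlgebra.qBinom] at h1 h2
  grind

theorem eq_of_taftCoord_skewPrimitive_zero_ne_zero
    (hy : Coalgebra.comul (R := K) y =
      y ⊗ₜ mk α (TaftAlgebra.h hm hq ^ e.val) (MonoidAlgebra.single g 1) + 1 ⊗ₜ y)
    {i : ZMod m} {s : G}
    (hs : taftCoord α y ((i, 0), s) ≠ 0) : (i = e ∧ s = g) ∨ (i = 0 ∧ s = 1) := by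
  have h1 := taftCoord_of_skewPrimitive hy i i 0 0 s s
  rw [if_pos (by simp)] at h1
  simp only [TaftAlgebra.qBinom] at h1
  grind

end SkewPrimitive

/-- The map `id ⊗ ε` is a left inverse. -/
theorem mk_one_injective : Function.Injective fun a => mk α a (1 : MonoidAlgebra K G) := by
  intro a b hab
  have h1 := congrArg ((TensorProduct.rid K _).toLinearMap ∘ₗ
    (Coalgebra.counit (R := K) (A := MonoidAlgebra K G)).lTensor _ ∘ₗ
    (ofTensor α).symm.toLinearMap) hab
  simpa [mk] using h1

/-- The rigidity at the heart of the theorem: the coalgebra structure leaves only `(c x + a + b h) #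
1` as image of `x # 1`, and the algebra relation `x h = q h x` removes `a + b h`. -/
theorem exists_bialgEquiv_h_x {α α' : SmashAction K (TaftAlgebra hm hq) (MonoidAlgebra K G)}
    (φ : SmashProduct α ≃ₐc[K] SmashProduct α') :
    φ (mk α (TaftAlgebra.h hm hq) 1) = mk α' (TaftAlgebra.h hm hq) 1 ∧
      ∃ c : K, φ (mk α (TaftAlgebra.x hm hq) 1) = mk α' (c • TaftAlgebra.x hm hq) 1 := by
  have : NeZero m := ⟨by omega⟩
  have hval1 : (1 : ZMod m).val = 1 := by
    have : Fact (1 < m) := ⟨hm⟩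
    exact ZMod.val_one m
  set h := TaftAlgebra.h hm hq with hh
  set x := TaftAlgebra.x hm hq with hx
  have hgl : IsGroupLikeElem K (mk α h 1) := by
    simpa [MonoidAlgebra.one_def] using isGroupLikeElem_mk α (isGroupLikeElem_h_pow (hq := hq) 1) 1
  obtain ⟨e, g, hφh⟩ := exists_eq_mk_of_isGroupLikeElem α' (hgl.map φ)
  set y := φ (mk α x 1) with hydef
  have hy : Coalgebra.comul (R := K) y =
      y ⊗ₜ mk α' (h ^ e.val) (MonoidAlgebra.single g 1) + 1 ⊗ₜ y := by
    rw [hydef, ← CoalgHomClass.map_comp_comul_apply, comul_mk, TaftAlgebra.comul_x, ← hφh,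
      Bialgebra.comul_one, Algebra.TensorProduct.one_def]
    simp [mkₗ_apply, ← one_def, hx, hh]
  -- Otherwise `y` would have `x`-degree zero, hence be a combination of group-likes; applying
  -- `φ.symm`, so would `x # 1`, whose coefficient at `x # 1` is `1`.
  obtain ⟨i, s, hne⟩ : ∃ i s, taftCoord α' y ((i, 1), s) ≠ 0 := by
    by_contra! hz
    have hmem : y ∈ Submodule.span K {z : SmashProduct α' | IsGroupLikeElem K z} := by
      refine mem_span_isGroupLikeElem α' fun i j hj s => ?_
      rcases Nat.lt_or_ge j 2 with h1 | h1
      · obtain rfl : j = 1 := by omega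
        exact hz i s
      · exact taftCoord_skewPrimitive_of_two_le hy i h1 s
    have hmem' : mk α x 1 ∈ Submodule.span K {z : SmashProduct α | IsGroupLikeElem K z} := by
      have h1 : mk α x 1 = φ.symm y := by simp [hydef]
      rw [h1]
      clear_value y
      clear hy hydef hz h1
      induction hmem using Submodule.span_induction with
      | mem z hz => exact Submodule.subset_span (hz.map φ.symm)
      | zero => simp
      | add y z _ _ hy hz => rw [map_add]; exact Submodule.add_mem _ hy hz
      | smul c y _ hy => rw [map_smul]; exact Submodule.smul_mem _ _ hy
    have h2 := taftCoord_eq_zero_of_mem_span α hmem' 0 one_pos 1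
    have h3 := TaftAlgebra.coord_monomial hm hq (0, 1) (by simp only; omega)
    simp only [TaftAlgebra.monomial, ZMod.val_zero, pow_zero, pow_one, one_mul, ← hx] at h3
    rw [MonoidAlgebra.one_def, taftCoord_mk, h3] at h2
    simp at h2
  obtain ⟨-, rfl, rfl⟩ := eq_of_taftCoord_skewPrimitive_one_ne_zero hy hne
  rw [hval1, pow_one, ← MonoidAlgebra.one_def] at hφh
  refine ⟨hφh, taftCoord α' y ((0, 1), 1), ?_⟩
  set c := taftCoord α' y ((0, 1), 1)
  set a := taftCoord α' y ((0, 0), 1)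
  set b := taftCoord α' y ((1, 0), 1)
  have h01 : (0 : ZMod m) ≠ 1 := by
    have : Fact (1 < m) := ⟨hm⟩
    exact zero_ne_one
  have hyform : y = mk α' (c • x + (a • 1 + b • h)) 1 := by
    have : taftCoord α' y = Finsupp.single ((0, 1), 1) c +
        (Finsupp.single ((0, 0), 1) a + Finsupp.single ((1, 0), 1) b) := by
      classical
      ext ⟨⟨i, j⟩, s⟩
      simp only [Finsupp.add_apply, Finsupp.single_apply, Prod.mk.injEq]
      rcases Nat.lt_or_ge j 2 with h1 | h1
      · interval_cases j
        · have := @eq_of_taftCoord_skewPrimitive_zero_ne_zero K _ m q hm hq G _ α' y 1 1 hy i s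
          grind
        · have := @eq_of_taftCoord_skewPrimitive_one_ne_zero K _ m q hm hq G _ α' y 1 1 hy i s
          grind
      · rw [taftCoord_skewPrimitive_of_two_le hy i h1 s]
        grind
    rw [← linearCombination_taftCoord α' y, this]
    simp [TaftAlgebra.monomial, hval1, ← hh, ← hx, ← MonoidAlgebra.one_def, ← mkₗ_apply]
  have hrel : y * mk α' h 1 = q • (mk α' h 1 * y) := by
    rw [hydef, ← hφh, ← map_mul, ← map_mul, ← map_smul, mk_one_mul_mk, mk_one_mul_mk,
      TaftAlgebra.x_mul_h, ← mkₗ_apply, map_smul]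
    rfl
  rw [hyform, mk_one_mul_mk, mk_one_mul_mk, ← mkₗ_apply, ← mkₗ_apply, ← LinearMap.smul_apply,
    ← map_smul] at hrel
  have hrel' := mk_one_injective α' hrel
  have hq1 : 1 - q ≠ 0 := sub_ne_zero.2 (hq.ne_one hm).symm
  -- The summand `c x` satisfies the relation by itself, while `a + b h` commutes with `h`; the
  -- difference of the two sides is what remains.
  have h1 : (1 - q) • ((a • 1 + b • h) * h) = 0 := by
    have hxh : (c • x) * h = q • (h * (c • x)) := by
      rw [smul_mul_assoc, TaftAlgebra.x_mul_h, mul_smul_comm, smul_comm]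
    rw [add_mul, mul_add, hxh, smul_add] at hrel'
    have h2 : h * (a • 1 + b • h) = (a • 1 + b • h) * h := by simp [mul_add, add_mul]
    rw [h2] at hrel'
    rw [sub_smul, one_smul, sub_eq_zero]
    exact add_left_cancel hrel'
  have h2 : a • 1 + b • h = 0 := by
    have h3 := (smul_eq_zero.1 h1).resolve_left hq1
    -- The inverse of `h` is `h ^ (m - 1)`.
    have h4 := congrArg (· * h ^ (m - 1)) h3
    simpa only [mul_assoc, hh, TaftAlgebra.h_mul_h_pow, mul_one, zero_mul] using h4
  rw [hyform, h2, add_zero]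

end SmashProduct

/-! ### Restriction to the Taft algebra and the induced automorphism of the group -/

namespace SmashProduct
section
variable {K A H : Type*} [Field K] [Ring A] [HopfAlgebra K A] [Ring H] [HopfAlgebra K H]
  (α : SmashAction K A H)

/-- The inclusion `A → A # H`. -/
noncomputable def inl : A →ₐ[K] SmashProduct α :=
  AlgHom.ofLinearMap ((mkₗ α).flip 1) rfl fun a b => (mk_one_mul_mk α a b 1).symm

theorem inl_apply (a : A) : inl α a = mk α a 1 := rfl

/-- Since `ε (y ▷ b) = ε(y) ε(b)`, applying `ε ⊗ id` to `a (y₁ ▷ b) # y₂ z` removes the action and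
leaves `ε(a) ε(b) y z`. This allows the group component of a product to be read off without knowing
the action. -/
theorem projRight_mul (s t : SmashProduct α) :
    projRight α (s * t) = projRight α s * projRight α t := by
  induction s using SmashProduct.induction with
  | h0 => simp
  | hadd s s' hs hs' => simp only [add_mul, map_add, hs, hs']
  | hmk a y =>
    induction t using SmashProduct.induction with
    | h0 => simp
    | hadd s t hs ht => simp only [mul_add, map_add, hs, ht]
    | hmk b z =>
      have key : ∀ w : H ⊗[K] H, projRight α (ofTensor α
          (TensorProduct.map (LinearMap.mul K A a ∘ₗ α.act.flip b) ((LinearMap.mul K H).flip z)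
            w)) = (Coalgebra.counit (R := K) a * Coalgebra.counit (R := K) b) •
          ((TensorProduct.lid K H (Coalgebra.counit.rTensor H w)) * z) := by
        intro w
        induction w with
        | zero => simp
        | add s t hs ht => simp only [map_add, add_mul, smul_add, hs, ht]
        | tmul p r =>
          change projRight α (mk α (a * α.act p b) (r * z)) = _
          rw [projRight_mk]
          simp [α.counit_act, smul_smul, mul_assoc, mul_comm]
      rw [mk_mul_mk, key, projRight_mk, projRight_mk]
      simp [smul_smul, mul_comm]

end

variable {K : Type*} [Field K] {m : ℕ} {q : K} {hm : 2 ≤ m} {hq : IsPrimitiveRoot q m}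
  {G : Type*} [Group G]

theorem projRight_h_pow (α : SmashAction K (TaftAlgebra hm hq) (MonoidAlgebra K G)) (n : ℕ)
    (g : G) : projRight α (mk α (TaftAlgebra.h hm hq ^ n) (MonoidAlgebra.single g 1)) =
      MonoidAlgebra.single g 1 := by
  rw [projRight_mk, (isGroupLikeElem_h_pow n).counit_eq_one, one_smul]

theorem single_left_injective : Function.Injective fun g : G => MonoidAlgebra.single g (1 : K) :=
  fun _ _ h => MonoidAlgebra.of_injective h

/-- The rescaling `h ↦ h`, `x ↦ c x` of the Taft algebra. -/
noncomputable def _root_.TaftAlgebra.rescale (hm : 2 ≤ m) (hq : IsPrimitiveRoot q m) (c : K) :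
    TaftAlgebra hm hq →ₐc[K] TaftAlgebra hm hq :=
  BialgHom.ofAlgHom
    (TaftAlgebra.lift hm hq (TaftAlgebra.h hm hq) (c • TaftAlgebra.x hm hq)
      (TaftAlgebra.h_pow hm hq)
      (by rw [smul_pow, TaftAlgebra.x_pow, smul_zero])
      (by rw [smul_mul_assoc, TaftAlgebra.x_mul_h, mul_smul_comm, smul_comm]))
    (by
      apply TaftAlgebra.algHom_ext
      · simp [TaftAlgebra.lift_h]
      · simp [TaftAlgebra.lift_x, TaftAlgebra.counit_x])
    (by
      apply TaftAlgebra.algHom_ext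
      · simp [TaftAlgebra.lift_h, TaftAlgebra.comul_h]
      · simp [TaftAlgebra.lift_h, TaftAlgebra.lift_x, TaftAlgebra.comul_x, TensorProduct.smul_tmul'])

theorem _root_.TaftAlgebra.rescale_h (c : K) :
    TaftAlgebra.rescale hm hq c (TaftAlgebra.h hm hq) = TaftAlgebra.h hm hq :=
  TaftAlgebra.lift_h ..

theorem _root_.TaftAlgebra.rescale_x (c : K) :
    TaftAlgebra.rescale hm hq c (TaftAlgebra.x hm hq) = c • TaftAlgebra.x hm hq :=
  TaftAlgebra.lift_x ..

/-- An isomorphism of smash products restricts to a rescaling of the Taft algebra. -/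
theorem exists_rescale {α α' : SmashAction K (TaftAlgebra hm hq) (MonoidAlgebra K G)}
    (φ : SmashProduct α ≃ₐc[K] SmashProduct α') :
    ∃ c : K, ∀ a, φ (mk α a 1) = mk α' (TaftAlgebra.rescale hm hq c a) 1 := by
  obtain ⟨h1, c, h2⟩ := exists_bialgEquiv_h_x φ
  refine ⟨c, fun a => ?_⟩
  have : (φ : SmashProduct α →ₐ[K] SmashProduct α').comp (inl α) =
      (inl α').comp (TaftAlgebra.rescale hm hq c : TaftAlgebra hm hq →ₐ[K] TaftAlgebra hm hq) := by
    apply TaftAlgebra.algHom_ext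
    · simpa [inl_apply, TaftAlgebra.rescale_h] using h1
    · change φ (mk α _ 1) = mk α' (TaftAlgebra.rescale hm hq c _) 1
      rw [TaftAlgebra.rescale_x, h2]
  exact DFunLike.congr_fun this a

/-- An isomorphism of smash products maps `1 # g` to `h ^ ρ g # σ g`, for an automorphism `σ` of the
group. -/
theorem exists_mulEquiv {α α' : SmashAction K (TaftAlgebra hm hq) (MonoidAlgebra K G)}
    (φ : SmashProduct α ≃ₐc[K] SmashProduct α') :
    ∃ (σ : G ≃* G) (ρ : G → ℕ), ∀ g, φ (mk α 1 (MonoidAlgebra.single g 1)) =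
      mk α' (TaftAlgebra.h hm hq ^ ρ g) (MonoidAlgebra.single (σ g) 1) := by
  have hgl (α : SmashAction K (TaftAlgebra hm hq) (MonoidAlgebra K G)) (g : G) :
      IsGroupLikeElem K (mk α 1 (MonoidAlgebra.single g 1)) := by
    simpa using isGroupLikeElem_mk α (isGroupLikeElem_h_pow (hq := hq) 0) g
  choose ρ σ hσ using fun g => exists_eq_mk_of_isGroupLikeElem α' ((hgl α g).map φ)
  have hh (n : ℕ) : φ (mk α (TaftAlgebra.h hm hq ^ n) 1) = mk α' (TaftAlgebra.h hm hq ^ n) 1 := by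
    rw [← inl_apply, ← inl_apply, map_pow, map_pow, map_pow, inl_apply, inl_apply,
      (exists_bialgEquiv_h_x φ).1]
  -- The projection `ε ⊗ id` sends `h ^ n # s` to `s`, so it turns multiplicativity of `φ` into
  -- multiplicativity of `σ`.
  have hmul (g g' : G) : σ (g * g') = σ g * σ g' := by
    apply single_left_injective (K := K)
    have h1 : mk α 1 (MonoidAlgebra.single g 1) * mk α 1 (MonoidAlgebra.single g' 1) =
        mk α 1 (MonoidAlgebra.single (g * g') (1 : K)) := by
      rw [mk_mul_mk_one, MonoidAlgebra.single_mul_single, mul_one]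
    have h2 := congrArg (fun z => projRight α' (φ z)) h1
    simp only [map_mul, projRight_mul, hσ, projRight_h_pow, MonoidAlgebra.single_mul_single,
      mul_one] at h2
    exact h2.symm
  let σ' : G →* G := MonoidHom.mk' σ hmul
  -- If `σ g = 1`, then `1 # g` and `h ^ n # 1`, with `n` the representative of `ρ g`, have the same
  -- image under `φ`. Hence they are equal, and projecting to `K[G]` gives `g = 1`.
  have hinj : Function.Injective σ' := by
    rw [injective_iff_map_eq_one]
    intro g hg
    have hg' : σ g = 1 := hg
    have h1 := hσ g
    rw [hg', ← MonoidAlgebra.one_def, ← hh] at h1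
    have h2 := congrArg (projRight α) (φ.injective h1)
    rw [MonoidAlgebra.one_def, projRight_h_pow, projRight_mk] at h2
    simp only [Bialgebra.counit_one, one_smul] at h2
    exact single_left_injective (K := K) h2
  have hsurj : Function.Surjective σ' := by
    intro g
    -- The preimage of `1 # g` is some `h ^ i # s`; as `φ` fixes `h ^ i # 1`, the group component of
    -- its image is `σ s`, so `σ s = g`.
    obtain ⟨i, s, hs⟩ := exists_eq_mk_of_isGroupLikeElem α ((hgl α' g).map φ.symm)
    refine ⟨s, single_left_injective (K := K) ?_⟩
    have h1 := congrArg (fun z => projRight α' (φ z)) hs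
    simp only [BialgEquiv.apply_symm_apply] at h1
    rw [mk_eq_mul α, map_mul, projRight_mul, hh, hσ, projRight_h_pow, MonoidAlgebra.one_def,
      projRight_h_pow, projRight_mk] at h1
    simp only [Bialgebra.counit_one, one_smul, MonoidAlgebra.single_mul_single, one_mul] at h1
    exact h1.symm
  exact ⟨MulEquiv.ofBijective σ' ⟨hinj, hsurj⟩, fun g => (ρ g).val, hσ⟩

end SmashProduct

/-! ### The factorisation of the isomorphism -/

/-- The coalgebra map on a monoid algebra given by a family of group-like elements. -/
noncomputable def MonoidAlgebra.liftCoalgHom {K A G : Type*} [Field K] [Ring A] [Bialgebra K A]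
    (f : G → A) (hf : ∀ g, IsGroupLikeElem K (f g)) : MonoidAlgebra K G →ₗc[K] A where
  toLinearMap := Finsupp.linearCombination K f ∘ₗ (MonoidAlgebra.coeffLinearEquiv K).toLinearMap
  counit_comp := by
    ext g
    simp [(hf g).counit_eq_one]
  map_comp_comul := by
    ext g
    simp [(hf g).comul_eq_tmul_self]

theorem MonoidAlgebra.liftCoalgHom_single {K A G : Type*} [Field K] [Ring A] [Bialgebra K A]
    (f : G → A) (hf : ∀ g, IsGroupLikeElem K (f g)) (g : G) :
    MonoidAlgebra.liftCoalgHom f hf (MonoidAlgebra.single g (1 : K)) = f g := by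
  change Finsupp.linearCombination K f (MonoidAlgebra.coeffLinearEquiv K _) = _
  simp

theorem mainTheorem3 {K : Type*} [Field K] {m : ℕ} (hm : 2 ≤ m) {q : K}
    (hq : IsPrimitiveRoot q m) {G : Type*} [Group G]
    (S : Set G) (hS : ∀ g ∈ S, IsOfFinOrder g) (hgen : Subgroup.closure S = ⊤)
    (α α' : SmashAction K (TaftAlgebra hm hq) (MonoidAlgebra K G))
    (φ : SmashProduct α ≃ₐc[K] SmashProduct α') :
    ∃ (u : TaftAlgebra hm hq →ₗc[K] TaftAlgebra hm hq)
      (r : MonoidAlgebra K G →ₗc[K] TaftAlgebra hm hq)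
      (v : MonoidAlgebra K G ≃ₐc[K] MonoidAlgebra K G),
      u 1 = 1 ∧ r 1 = 1 ∧
      (∃ σ : G ≃* G, ∀ g : G, v (MonoidAlgebra.of K G g) = MonoidAlgebra.of K G (σ g)) ∧
      -- `φ (a # t) = u(a) r(t₁) #' v(t₂)`
      (∀ (a : TaftAlgebra hm hq) (t : MonoidAlgebra K G),
        φ (SmashProduct.mk α a t) =
          SmashProduct.ofTensor α' (TensorProduct.map
            (LinearMap.mulLeft K (u a) ∘ₗ (r : MonoidAlgebra K G →ₗ[K] TaftAlgebra hm hq))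
            (v : MonoidAlgebra K G →ₗ[K] MonoidAlgebra K G)
            (Coalgebra.comul t))) ∧
      -- the component `p(a) = (ε ⊗ id)(φ (a # 1))` is trivial
      (∀ a : TaftAlgebra hm hq,
        SmashProduct.projRight α' (φ (SmashProduct.mk α a 1)) =
          Coalgebra.counit (R := K) a • (1 : MonoidAlgebra K G)) := by
  obtain ⟨c, hc⟩ := SmashProduct.exists_rescale φ
  obtain ⟨σ, ρ, hσ⟩ := SmashProduct.exists_mulEquiv φ
  have hv (g : G) : MonoidAlgebra.domCongrBialgEquiv K K σ (MonoidAlgebra.single g 1) =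
      MonoidAlgebra.single (σ g) 1 := by
    simp [MonoidAlgebra.domCongrBialgEquiv]
  have hr (g : G) := MonoidAlgebra.liftCoalgHom_single (K := K) _
    (fun g => SmashProduct.isGroupLikeElem_h_pow (hm := hm) (hq := hq) (ρ g)) g
  refine ⟨TaftAlgebra.rescale hm hq c, MonoidAlgebra.liftCoalgHom _
    (fun g => SmashProduct.isGroupLikeElem_h_pow (ρ g)),
    MonoidAlgebra.domCongrBialgEquiv K K σ, map_one (TaftAlgebra.rescale hm hq c), ?_,
    ⟨σ, hv⟩, ?_, ?_⟩
  · rw [MonoidAlgebra.one_def, hr]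
    -- The exponent `ρ 1` is a chosen natural number; `φ 1 = 1` and the injectivity of `a ↦ a # 1`
    -- give `h ^ ρ 1 = 1`.
    have h1 := hσ 1
    rw [map_one σ, ← MonoidAlgebra.one_def, ← SmashProduct.one_def, map_one,
      SmashProduct.one_def] at h1
    exact (SmashProduct.mk_one_injective α' h1).symm
  · intro a t
    induction t using MonoidAlgebra.induction_linear with
    | zero => rw [← SmashProduct.mkₗ_apply]; simp
    | add y z hy hz =>
      rw [← SmashProduct.mkₗ_apply] at hy hz ⊢
      simp only [map_add, hy, hz]
    | single g k =>
      have hk : MonoidAlgebra.single g k = k • MonoidAlgebra.single g (1 : K) := by simp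
      have hg : Coalgebra.comul (R := K) (MonoidAlgebra.single g (1 : K)) =
        MonoidAlgebra.single g (1 : K) ⊗ₜ MonoidAlgebra.single g (1 : K) := by simp
      rw [hk, ← SmashProduct.mkₗ_apply]
      simp only [map_smul]
      congr 1
      -- For `t = g` group-like, the right side is `u(a) r(g) # v(g)`, and the left side is `(u(a) #
      -- 1) (h ^ ρ g # σ g)`, a product in which only `1` acts.
      rw [SmashProduct.mkₗ_apply, SmashProduct.mk_eq_mul, map_mul, hc, hσ,
        SmashProduct.mk_one_mul_mk, hg, TensorProduct.map_tmul]
      exact congrArg₂ (SmashProduct.mk α') (congrArg _ (hr g).symm) (hv g).symm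
  · intro a
    rw [hc, SmashProduct.projRight_mk]
    congr 1
    exact CoalgHomClass.counit_comp_apply (TaftAlgebra.rescale hm hq c) a
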